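/- All graphs are finite, simple and undirected. Let $G$ be a graph of order $n$ with vertex set $V(G)$, and let $Y$ be one of the parameters power domination ($\gamma_P$) or positive semidefinite forcing ($\mathrm{Z}_+$). **Propagation.** For a set $B\subseteq V(G)$ of initially filled vertices put $B^{[0]}=B$, and let $B^{[t+1]}$ be the union of $B^{[t]}$ with the set of all vertices that can be filled when exactly the vertices of $B^{[t]}$ are filled, where: - for $Y=\mathrm{Z}_+$, in every step, an unfilled vertex $w$ can be filled if some filled vertex $v$ has $w$ as its only unfilled neighbor within the connected component containing $w$ of the subgraph induced by the unfilled vertices; - for $Y=\gamma_P$, in the first step every neighbor of a filled vertex can be filled; in every later step, an unfilled vertex $w$ can be filled if it is the only unfilled neighbor of some filled vertex. Let $\operatorname{pt}_Y(G,B)$ be the least $t$ with $B^{[t]}=V(G)$, and $\infty$ if there is none. Define $$\operatorname{th}_Y^\times(G)=\min_{1\le |B|\le n}|B|\,(1+\operatorname{pt}_Y(G,B)),$$ and, for graphs $G$ that have at least one edge, $$\operatorname{th}_Y^\ast(G)=\min_{1\le |B|\le n-1}|B|\operatorname{pt}_Y(G,B).$$ Write $\operatorname{th}_+$ for $\operatorname{th}_{\mathrm{Z}_+}$.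 **Operations.** For a vertex $x$ and an edge $e=uv$ of $G$: $G-x$ and $G-e$ are obtained by deleting $x$ (with its incident edges) and $e$ respectively; $G/e$ is obtained by identifying $u$ and $v$ and suppressing loops and multiple edges; $G_e$ is obtained by removing $e$ and adding a new vertex $z$ and the edges $uz$, $vz$. **Proposition 3.2.** Let $G$ be a graph, $x$ a vertex of $G$ and $e$ an edge of $G$. In (1)–(4), the inequalities that involve $\operatorname{th}^\ast$ are asserted whenever the modified graph ($G-e$, $G-x$ or $G/e$) has at least one edge; the inequality for $\operatorname{th}_Y^\times$ in (2) is asserted whenever $G$ has at least two vertices. For $Y\in\{\gamma_P,\mathrm{Z}_+\}$: 1. $\frac12\operatorname{th}_Y^\ast(G)\le \operatorname{th}_Y^\ast(G-e)\le 2\operatorname{th}_Y^\ast(G)$ and $\frac12\operatorname{th}_Y^\times(G)\le \operatorname{th}_Y^\times(G-e)\le 2\operatorname{th}_Y^\times(G)$. 2. $\frac12\operatorname{th}_Y^\ast(G)\le \operatorname{th}_Y^\ast(G-x)$ and $\frac12\operatorname{th}_Y^\times(G)\le \operatorname{th}_Y^\times(G-x)$. 3. $\frac12\operatorname{th}_{\gamma_P}^\ast(G)\le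 \operatorname{th}_{\gamma_P}^\ast(G/e)\le 2\operatorname{th}_{\gamma_P}^\ast(G)$ and $\frac12\operatorname{th}_{\gamma_P}^\times(G)\le \operatorname{th}_{\gamma_P}^\times(G/e)\le 2\operatorname{th}_{\gamma_P}^\times(G)$. 4. $\frac12\operatorname{th}_+^\ast(G)\le \operatorname{th}_+^\ast(G/e)$ and $\frac12\operatorname{th}_+^\times(G)\le \operatorname{th}_+^\times(G/e)$. 5. $\operatorname{th}_Y^\ast(G)\le \operatorname{th}_Y^\ast(G_e)\le 2\operatorname{th}_Y^\ast(G)$. 6. $\operatorname{th}_{\gamma_P}^\times(G)\le \operatorname{th}_{\gamma_P}^\times(G_e)\le 2\operatorname{th}_{\gamma_P}^\times(G)$ and $\operatorname{th}_+^\times(G)\le \operatorname{th}_+^\times(G_e)\le \frac32\operatorname{th}_+^\times(G)$. Each of these inequalities is sharp: for every one of them, and for each parameter $Y$ for which it is stated, there is a graph $G$ with an edge $e$ (respectively a vertex $x$) for which equality holds; in (1)–(4) the example can be chosen so that the modified graph has an edge. -/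

import Mathlib

namespace ProductThrottling

/-! ### Graph operations -/

section Operations

variable {V : Type*}

/-- The equivalence relation that identifies the two endpoints of `e` and no other vertices. -/
def endpointSetoid (e : Sym2 V) : Setoid V where
  r a b := a = b ∨ (a ∈ e ∧ b ∈ e)
  iseqv := by
    refine ⟨fun a => Or.inl rfl, ?_, ?_⟩
    · rintro a b (h | ⟨h₁, h₂⟩)
      · exact Or.inl h.symm
      · exact Or.inr ⟨h₂, h₁⟩
    · rintro a b c (rfl | ⟨h₁, h₂⟩) (rfl | ⟨h₃, h₄⟩)
      · exact Or.inl rfl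
      · exact Or.inr ⟨h₃, h₄⟩
      · exact Or.inr ⟨h₁, h₂⟩
      · exact Or.inr ⟨h₁, h₄⟩

/-- The contraction `G / e`: the endpoints of `e` are identified, and loops and multiple edges
are suppressed (`SimpleGraph.map` discards loops). -/
def contractEdge (G : SimpleGraph V) (e : Sym2 V) :
    SimpleGraph (Quotient (endpointSetoid e)) :=
  G.map (Quotient.mk (endpointSetoid e))

/-- The subdivision `G_e`: the new vertex `none` is joined to the two endpoints of `e`,
and `e` is removed. -/
def subdivideEdge (G : SimpleGraph V) (e : Sym2 V) : SimpleGraph (Option V) where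
  Adj
    | some a, some b => G.Adj a b ∧ s(a, b) ≠ e
    | some a, none => a ∈ e
    | none, some b => b ∈ e
    | none, none => False
  symm := ⟨by
    rintro (_ | a) (_ | b) h
    · exact h
    · exact h
    · exact h
    · exact ⟨h.1.symm, by rw [Sym2.eq_swap]; exact h.2⟩⟩
  loopless := ⟨by
    rintro (_ | a) h
    · exact h
    · exact G.irrefl h.1⟩

/-- The deletion `G - e` of an edge. -/
def deleteEdge (G : SimpleGraph V) (e : Sym2 V) : SimpleGraph V :=
  G.deleteEdges {e}

/-- The deletion `G - x` of a vertex, together with all edges incident to it. -/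
def deleteVertex (G : SimpleGraph V) (x : V) : SimpleGraph ({x}ᶜ : Set V) :=
  G.induce {x}ᶜ

end Operations

/-! ### Propagation -/

/-- The parameter `Y`: power domination or positive semidefinite forcing. -/
inductive Param
  | powerDomination
  | psdForcing

section Propagation

variable {V : Type*}

/-- The vertices that have a neighbor in `S` (those filled by a domination step). -/
def dominated (G : SimpleGraph V) (S : Set V) : Set V :=
  {w | ∃ v ∈ S, G.Adj v w}

/-- The vertices that the standard color change rule fills when `S` is the set of filled
vertices: `w` is the unique unfilled neighbor of some filled vertex `v`. -/
def standardForced (G : SimpleGraph V) (S : Set V) : Set V :=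
  {w | w ∉ S ∧ ∃ v ∈ S, G.Adj v w ∧ ∀ x, x ∉ S → G.Adj v x → x = w}

/-- The vertices that the positive semidefinite color change rule fills when `S` is the set of
filled vertices: `w` is the unique unfilled neighbor of some filled vertex `v` inside the
component of `G[V ∖ S]` that contains `w`. -/
def psdForced (G : SimpleGraph V) (S : Set V) : Set V :=
  {w | ∃ hw : w ∈ Sᶜ, ∃ v ∈ S, G.Adj v w ∧
    ∀ (x : V) (hx : x ∈ Sᶜ), (G.induce Sᶜ).Reachable ⟨w, hw⟩ ⟨x, hx⟩ → G.Adj v x → x = w}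

/-- The vertices filled in time step `t + 1`, if `S` is the set of vertices filled after time
step `t`. -/
def newlyFilled (Y : Param) (G : SimpleGraph V) (t : ℕ) (S : Set V) : Set V :=
  match Y, t with
  | .powerDomination, 0 => dominated G S
  | .powerDomination, _ + 1 => standardForced G S
  | .psdForcing, _ => psdForced G S

/-- `filledAfter Y G B t` is the set `B^{[t]}` of vertices that are filled after time step `t`,
starting with the set `B` of filled vertices. -/
def filledAfter (Y : Param) (G : SimpleGraph V) (B : Set V) : ℕ → Set V
  | 0 => B
  | t + 1 => filledAfter Y G B t ∪ newlyFilled Y G t (filledAfter Y G B t)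

/-- The propagation time of `B`: the least `t` such that all vertices are filled after time
step `t`, and `⊤` if there is no such `t`. -/
noncomputable def propTime (Y : Param) (G : SimpleGraph V) (B : Set V) : ℕ∞ :=
  ⨅ (t : ℕ) (_ : filledAfter Y G B t = Set.univ), (t : ℕ∞)

/-! ### Product throttling

All infima are minima over finite sets of values in `ℕ∞`. -/

/-- Initial cost product throttling number of a set, `|B| (1 + pt_Y(G, B))`. -/
noncomputable def thTimesSet (Y : Param) (G : SimpleGraph V) (B : Set V) : ℕ∞ :=
  (B.ncard : ℕ∞) * (1 + propTime Y G B)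

/-- Initial cost product throttling number with exactly `k` initially filled vertices. -/
noncomputable def thTimesK (Y : Param) (G : SimpleGraph V) (k : ℕ) : ℕ∞ :=
  ⨅ (B : Set V) (_ : B.ncard = k), thTimesSet Y G B

/-- Initial cost product throttling number `th_Y^×(G)` of a finite graph: the minimum over
`1 ≤ k ≤ n`, where `n` is the order of `G`. -/
noncomputable def thTimes (Y : Param) (G : SimpleGraph V) : ℕ∞ :=
  ⨅ (k : ℕ) (_ : 1 ≤ k ∧ k ≤ Nat.card V), thTimesK Y G k

/-- No initial cost product throttling number of a set, `|B| pt_Y(G, B)`. -/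
noncomputable def thStarSet (Y : Param) (G : SimpleGraph V) (B : Set V) : ℕ∞ :=
  (B.ncard : ℕ∞) * propTime Y G B

/-- No initial cost product throttling number with exactly `k` initially filled vertices. -/
noncomputable def thStarK (Y : Param) (G : SimpleGraph V) (k : ℕ) : ℕ∞ :=
  ⨅ (B : Set V) (_ : B.ncard = k), thStarSet Y G B

/-- No initial cost product throttling number `th_Y^*(G)` of a finite graph that has an edge:
the minimum over `1 ≤ k ≤ n - 1`, where `n` is the order of `G`. -/
noncomputable def thStar (Y : Param) (G : SimpleGraph V) : ℕ∞ :=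
  ⨅ (k : ℕ) (_ : 1 ≤ k ∧ k ≤ Nat.card V - 1), thStarK Y G k

/-- The graph has an edge, so that `th_Y^*` is defined for it. -/
def HasEdge (G : SimpleGraph V) : Prop :=
  G.edgeSet.Nonempty

end Propagation

end ProductThrottling

/-! The bounds come from transferring filling sets. If `B` fills one graph in time `t`, a set `B'`
with `|B'| ≤ |B| + 1 ≤ 2|B|` fills the other graph in the same time, because one extra vertex
neutralizes the local change. For a deleted or restored edge the extra vertex is the endpoint that
is filled last; for a deleted vertex it is that vertex. To undo a contraction it is the endpoint of
`e` through which the merged vertex is not filled. For power domination on `G/e` and `G_e` it is the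
merged or the new vertex, whose neighbors are then all filled in the first step.

Two cases need no extra vertex. Undoing a subdivision is free: an initially filled new vertex is
exchanged for the endpoint of `e` that is filled later. Under positive semidefinite forcing a
subdivision costs at most one time step, and `t + 1 ≤ 2t` and `2(t + 2) ≤ 3(t + 1)` for `t ≥ 1`; for
`t = 0` the second bound becomes `2(n + 1) ≤ 3n`.

The rules are treated uniformly: a filled `v` fills its neighbor `w` unless another unfilled
neighbor of `v` blocks `w` (`mem_step`). Each transfer shows by induction on time that one filled
set contains the other, and `Blocks.map` carries blocking vertices back along walks through unfilled
vertices.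

For sharpness it then suffices to find a small graph with one number at most `s` and the other at
least `2s`. Stars, triangles and short paths often do. The harder power domination examples have a
hub that fills everything quickly, until the operation gives some vertex two unfilled neighbors at
once; additional legs and leaves make all other sets expensive, which is checked exhaustively on bit
masks. -/

namespace ProductThrottling

/-! ### A common form of the color change rules -/

section Filling

variable {V W : Type*}

/-- In time step `t + 1`, with `S` filled, a filled vertex adjacent to `w` and to the unfilled
vertex `x ≠ w` cannot fill `w`. -/
def Blocks (Y : Param) (G : SimpleGraph V) (t : ℕ) (S : Set V) (w x : V) : Prop :=
  match Y, t with
  | .powerDomination, 0 => False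
  | .powerDomination, _ + 1 => True
  | .psdForcing, _ => Relation.ReflTransGen (fun a b => G.Adj a b ∧ b ∉ S) w x

/-- The vertices filled after time step `t + 1` if `S` is filled after time step `t`. -/
def step (Y : Param) (G : SimpleGraph V) (t : ℕ) (S : Set V) : Set V :=
  S ∪ newlyFilled Y G t S

/-- Replaces reachability in a subtype by a relation on `V` itself, which can be mapped along
functions between vertex sets. -/
lemma induce_reachable_iff {G : SimpleGraph V} {S : Set V} {w x : V} (hw : w ∈ Sᶜ) (hx : x ∈ Sᶜ) :
    (G.induce Sᶜ).Reachable ⟨w, hw⟩ ⟨x, hx⟩ ↔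
      Relation.ReflTransGen (fun a b => G.Adj a b ∧ b ∉ S) w x := by
  rw [SimpleGraph.reachable_iff_reflTransGen]
  constructor
  · intro h
    exact h.lift Subtype.val fun a b hab => ⟨hab, b.2⟩
  · intro h
    induction h with
    | refl => exact .refl
    | tail hab hbc ih =>
      rename_i b c
      by_cases hb : b ∈ Sᶜ
      · exact (ih hb).tail hbc.1
      -- An intermediate vertex is either the unfilled start `w` or the target of an earlier step,
      -- hence unfilled.
      · rcases hab.cases_tail with h | ⟨_, _, h⟩
        · exact absurd (h ▸ hw) hb
        · exact absurd h.2 hb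

lemma mem_step {Y : Param} {G : SimpleGraph V} {t : ℕ} {S : Set V} {w : V} :
    w ∈ step Y G t S ↔ w ∈ S ∨
      ∃ v ∈ S, G.Adj v w ∧ ∀ x, x ∉ S → Blocks Y G t S w x → G.Adj v x → x = w := by
  unfold step
  rw [Set.mem_union]
  by_cases hw : w ∈ S
  · simp [hw]
  simp only [hw, false_or]
  match Y, t with
  | .powerDomination, 0 => simp [newlyFilled, dominated, Blocks]
  | .powerDomination, _ + 1 => simp [newlyFilled, standardForced, Blocks, hw]
  | .psdForcing, _ =>
    simp only [newlyFilled, psdForced, Blocks, Set.mem_ofPred_eq]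
    constructor
    · rintro ⟨hw', v, hv, hvw, h⟩
      exact ⟨v, hv, hvw, fun x hx hr => h x hx ((induce_reachable_iff hw' hx).2 hr)⟩
    · rintro ⟨v, hv, hvw, h⟩
      exact ⟨hw, v, hv, hvw, fun x hx hr => h x hx ((induce_reachable_iff hw hx).1 hr)⟩

lemma filledAfter_succ (Y : Param) (G : SimpleGraph V) (B : Set V) (t : ℕ) :
    filledAfter Y G B (t + 1) = step Y G t (filledAfter Y G B t) := rfl

lemma subset_step (Y : Param) (G : SimpleGraph V) (t : ℕ) (S : Set V) : S ⊆ step Y G t S :=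
  Set.subset_union_left

lemma filledAfter_mono (Y : Param) (G : SimpleGraph V) (B : Set V) :
    Monotone (filledAfter Y G B) :=
  monotone_nat_of_le_succ fun _ => Set.subset_union_left

/-- A map of graphs that sends edges between unfilled vertices to walks through unfilled vertices
transports blocking vertices. -/
lemma Blocks.map {Y : Param} {G : SimpleGraph V} {H : SimpleGraph W} {t : ℕ} {S : Set V}
    {T : Set W} (φ : W → V)
    (h : ∀ a b, a ∉ T → b ∉ T → H.Adj a b →
      Relation.ReflTransGen (fun a b => G.Adj a b ∧ b ∉ S) (φ a) (φ b))
    {w x : W} (hw : w ∉ T) (hb : Blocks Y H t T w x) : Blocks Y G t S (φ w) (φ x) := by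
  match Y, t with
  | .powerDomination, 0 => exact hb
  | .powerDomination, _ + 1 => trivial
  | .psdForcing, _ =>
    simp only [Blocks] at hb ⊢
    -- The induction must also carry that the current vertex is unfilled, since `h` needs both ends
    -- of each edge unfilled.
    suffices Relation.ReflTransGen (fun a b => G.Adj a b ∧ b ∉ S) (φ w) (φ x) ∧ x ∉ T from this.1
    induction hb with
    | refl => exact ⟨.refl, hw⟩
    | tail _ hbc ih => exact ⟨ih.1.trans (h _ _ ih.2 hbc.2 hbc.1), hbc.2⟩

/-- With more vertices filled there are fewer walks through unfilled vertices, so every blocking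
vertex for `T` already blocks for `S`. -/
lemma step_mono {Y : Param} {G : SimpleGraph V} {t : ℕ} {S T : Set V} (h : S ⊆ T) :
    step Y G t S ⊆ step Y G t T := by
  intro w hw
  rw [mem_step] at hw ⊢
  by_cases hwT : w ∈ T
  · exact Or.inl hwT
  rcases hw with hw | ⟨v, hv, hvw, hx⟩
  · exact Or.inl (h hw)
  · refine Or.inr ⟨v, h hv, hvw, fun x hxT hb => hx x (fun hxS => hxT (h hxS)) ?_⟩
    exact hb.map id (fun a b _ hb hab => .single ⟨hab, fun hbS => hb (h hbS)⟩) hwT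

end Filling

/-! ### Throttling numbers as minima over filling sets -/

section Throttling

variable {V W : Type*}

lemma propTime_le {Y : Param} {G : SimpleGraph V} {B : Set V} {t : ℕ}
    (h : filledAfter Y G B t = Set.univ) : propTime Y G B ≤ t :=
  iInf₂_le t h

/-- The function `f` is `p ↦ p` or `p ↦ 1 + p`, so that both throttling numbers are covered. An
infinite propagation time is harmless because `B` is nonempty. -/
lemma le_propTime_mul {Y : Param} {G : SimpleGraph V} {B : Set V} {c : ℕ∞} (hB : B.ncard ≠ 0)
    (f : ℕ∞ → ℕ∞) (hf : f ⊤ = ⊤)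
    (h : ∀ t : ℕ, filledAfter Y G B t = Set.univ → c ≤ B.ncard * f t) :
    c ≤ B.ncard * f (propTime Y G B) := by
  by_cases hp : propTime Y G B = ⊤
  · rw [hp, hf, ENat.mul_top (by exact_mod_cast hB)]
    exact le_top
  · have hne : ∃ t, filledAfter Y G B t = Set.univ := by
      by_contra hc
      push Not at hc
      exact hp (by simp [propTime, hc])
    classical
    have : propTime Y G B = Nat.find hne := by
      refine le_antisymm (propTime_le (Nat.find_spec hne)) (le_iInf₂ fun t ht => ?_)
      exact_mod_cast Nat.find_min' hne ht
    rw [this]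
    exact h _ (Nat.find_spec hne)

lemma thTimes_le [Finite V] {Y : Param} {G : SimpleGraph V} {B : Set V} {t : ℕ}
    (hB : B.Nonempty) (h : filledAfter Y G B t = Set.univ) :
    thTimes Y G ≤ B.ncard * (1 + t : ℕ∞) := by
  refine (iInf₂_le B.ncard ⟨?_, ?_⟩).trans
    ((iInf₂_le (f := fun C (_ : C.ncard = B.ncard) => thTimesSet Y G C) B rfl).trans ?_)
  · exact mul_le_mul_right (add_le_add_right (propTime_le h) _) _
  · exact (Set.ncard_pos).2 hB
  · exact Set.ncard_le_card B

lemma le_thTimes {Y : Param} {G : SimpleGraph V} {c : ℕ∞}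
    (h : ∀ (B : Set V) (t : ℕ), B.Nonempty → filledAfter Y G B t = Set.univ →
      c ≤ B.ncard * (1 + t : ℕ∞)) : c ≤ thTimes Y G := by
  refine le_iInf₂ fun k hk => le_iInf₂ fun B hBk => ?_
  have h0 : B.ncard ≠ 0 := by omega
  exact le_propTime_mul h0 (fun p => 1 + p) (by simp)
    fun t ht => h B t (Set.nonempty_of_ncard_ne_zero h0) ht

lemma le_thStar [Finite V] {Y : Param} {G : SimpleGraph V} {c : ℕ∞}
    (h : ∀ (B : Set V) (t : ℕ), B.Nonempty → 1 ≤ t → filledAfter Y G B t = Set.univ →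
      c ≤ B.ncard * (t : ℕ∞)) : c ≤ thStar Y G := by
  refine le_iInf₂ fun k hk => le_iInf₂ fun B hBk => ?_
  have h0 : B.ncard ≠ 0 := by omega
  refine le_propTime_mul h0 (fun p => p) rfl
    fun t ht => h B t (Set.nonempty_of_ncard_ne_zero h0) ?_ ht
  by_contra ht0
  obtain rfl : t = 0 := by omega
  have : B = Set.univ := ht
  rw [this, Set.ncard_univ] at hBk
  omega

lemma HasEdge.exists_adj {G : SimpleGraph V} (hG : HasEdge G) :
    ∃ u v, G.Adj u v := by
  obtain ⟨e, he⟩ := hG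
  induction e with
  | h u v => exact ⟨u, v, he⟩

/-- Trades the constraint `|B| ≤ n - 1` for `t ≥ 1`, which survives enlarging `B`. If `B` is
everything, omitting an endpoint of an edge gives a smaller set that fills the graph in one step. -/
lemma thStar_le [Finite V] {Y : Param} {G : SimpleGraph V} (hG : HasEdge G) {B : Set V} {t : ℕ}
    (hB : B.Nonempty) (ht : 1 ≤ t) (h : filledAfter Y G B t = Set.univ) :
    thStar Y G ≤ B.ncard * (t : ℕ∞) := by
  have key : ∀ (B : Set V) (t : ℕ), B.Nonempty → B ≠ Set.univ → filledAfter Y G B t = Set.univ →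
      thStar Y G ≤ B.ncard * (t : ℕ∞) := by
    intro B t hB hu h
    refine (iInf₂_le B.ncard ⟨(Set.ncard_pos).2 hB, ?_⟩).trans
      ((iInf₂_le (f := fun C (_ : C.ncard = B.ncard) => thStarSet Y G C) B rfl).trans ?_)
    · exact mul_le_mul_right (propTime_le h) _
    · have := Set.ncard_lt_card hu
      omega
  by_cases hu : B = Set.univ
  · obtain ⟨u, v, huv⟩ := hG.exists_adj
    have hv : v ∈ ({u}ᶜ : Set V) := by simpa using huv.ne'
    refine (key {u}ᶜ 1 ⟨v, hv⟩ (by simp) ?_).trans ?_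
    · refine Set.eq_univ_of_forall fun w => mem_step.2 ?_
      by_cases hw : w = u
      · subst hw
        refine Or.inr ⟨v, hv, huv.symm, fun x hx _ _ => ?_⟩
        simpa [filledAfter] using hx
      · exact Or.inl (by simpa [filledAfter] using hw)
    · subst hu
      exact_mod_cast Nat.mul_le_mul (Set.ncard_le_ncard (Set.subset_univ _)) ht
  · exact key B t hB hu h

lemma thStar_attained [Finite V] {Y : Param} {G : SimpleGraph V} (hG : HasEdge G)
    (h : thStar Y G ≠ ⊤) : ∃ (B : Set V) (t : ℕ), B.Nonempty ∧ 1 ≤ t ∧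
      filledAfter Y G B t = Set.univ ∧ thStar Y G = B.ncard * (t : ℕ∞) := by
  have heq : thStar Y G = sInf {c : ℕ∞ | ∃ (B : Set V) (t : ℕ), B.Nonempty ∧ 1 ≤ t ∧
      filledAfter Y G B t = Set.univ ∧ c = B.ncard * (t : ℕ∞)} := by
    refine le_antisymm (le_sInf ?_) (le_thStar fun B t h1 h2 h3 => sInf_le ⟨B, t, h1, h2, h3, rfl⟩)
    rintro _ ⟨B, t, h1, h2, h3, rfl⟩
    exact thStar_le hG h1 h2 h3
  have hne : {c : ℕ∞ | ∃ (B : Set V) (t : ℕ), B.Nonempty ∧ 1 ≤ t ∧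
      filledAfter Y G B t = Set.univ ∧ c = B.ncard * (t : ℕ∞)}.Nonempty := by
    by_contra hc
    rw [Set.not_nonempty_iff_eq_empty] at hc
    rw [heq, hc, sInf_empty] at h
    exact h rfl
  obtain ⟨B, t, h1, h2, h3, h4⟩ := csInf_mem hne
  exact ⟨B, t, h1, h2, h3, heq.trans h4⟩

lemma thTimes_attained [Finite V] {Y : Param} {G : SimpleGraph V}
    (h : thTimes Y G ≠ ⊤) : ∃ (B : Set V) (t : ℕ), B.Nonempty ∧
      filledAfter Y G B t = Set.univ ∧ thTimes Y G = B.ncard * (1 + t : ℕ∞) := by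
  have heq : thTimes Y G = sInf {c : ℕ∞ | ∃ (B : Set V) (t : ℕ), B.Nonempty ∧
      filledAfter Y G B t = Set.univ ∧ c = B.ncard * (1 + t : ℕ∞)} := by
    refine le_antisymm (le_sInf ?_) (le_thTimes fun B t h1 h3 => sInf_le ⟨B, t, h1, h3, rfl⟩)
    rintro _ ⟨B, t, h1, h3, rfl⟩
    exact thTimes_le h1 h3
  have hne : {c : ℕ∞ | ∃ (B : Set V) (t : ℕ), B.Nonempty ∧
      filledAfter Y G B t = Set.univ ∧ c = B.ncard * (1 + t : ℕ∞)}.Nonempty := by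
    by_contra hc
    rw [Set.not_nonempty_iff_eq_empty] at hc
    rw [heq, hc, sInf_empty] at h
    exact h rfl
  obtain ⟨B, t, h1, h3, h4⟩ := csInf_mem hne
  exact ⟨B, t, h1, h3, heq.trans h4⟩

/-- If every filling set of `H` yields a filling set of `G` with at most `m` more vertices
and no larger propagation time, then the throttling numbers grow at most by the factor `1 + m`. -/
lemma thStar_le_mul [Finite V] [Finite W] {Y : Param} {G : SimpleGraph V} {H : SimpleGraph W}
    (hG : HasEdge G) (hH : HasEdge H) (m : ℕ)
    (h : ∀ (B : Set W) (t : ℕ), B.Nonempty → filledAfter Y H B t = Set.univ →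
      ∃ B' : Set V, B'.Nonempty ∧ B'.ncard ≤ B.ncard + m ∧ filledAfter Y G B' t = Set.univ) :
    thStar Y G ≤ (1 + m : ℕ) * thStar Y H := by
  by_cases htop : thStar Y H = ⊤
  · rw [htop, ENat.mul_top (by norm_cast; omega)]
    exact le_top
  obtain ⟨B, t, h1, h2, h3, h4⟩ := thStar_attained hH htop
  obtain ⟨B', h5, h6, h7⟩ := h B t h1 h3
  refine (thStar_le hG h5 h2 h7).trans ?_
  rw [h4]
  have h8 : 1 ≤ B.ncard := (Set.ncard_pos).2 h1
  -- Since `|B| ≥ 1`, the additive `m` is at most `m * |B|`.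
  have h9 : B'.ncard ≤ (1 + m) * B.ncard := by nlinarith
  rw [← mul_assoc]
  exact_mod_cast Nat.mul_le_mul_right t h9

lemma thTimes_le_mul [Finite V] [Finite W] {Y : Param} {G : SimpleGraph V} {H : SimpleGraph W}
    (m : ℕ)
    (h : ∀ (B : Set W) (t : ℕ), B.Nonempty → filledAfter Y H B t = Set.univ →
      ∃ B' : Set V, B'.Nonempty ∧ B'.ncard ≤ B.ncard + m ∧ filledAfter Y G B' t = Set.univ) :
    thTimes Y G ≤ (1 + m : ℕ) * thTimes Y H := by
  by_cases htop : thTimes Y H = ⊤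
  · rw [htop, ENat.mul_top (by norm_cast; omega)]
    exact le_top
  obtain ⟨B, t, h1, h3, h4⟩ := thTimes_attained htop
  obtain ⟨B', h5, h6, h7⟩ := h B t h1 h3
  refine (thTimes_le h5 h7).trans ?_
  rw [h4]
  have h8 : 1 ≤ B.ncard := (Set.ncard_pos).2 h1
  have h9 : B'.ncard ≤ (1 + m) * B.ncard := by nlinarith
  rw [← mul_assoc]
  exact_mod_cast Nat.mul_le_mul_right (1 + t) h9

end Throttling

/-! ### Deleting an edge or a vertex -/

section Bounds

variable {V : Type*}

/-- The filled sets form a chain, so one of two given vertices is never filled after the other. -/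
lemma subset_or_subset_of_filledAfter (Y : Param) (G : SimpleGraph V) (B : Set V) (u v : V) :
    (∀ t, v ∈ filledAfter Y G B t → u ∈ filledAfter Y G B t) ∨
      (∀ t, u ∈ filledAfter Y G B t → v ∈ filledAfter Y G B t) := by
  by_contra! h
  obtain ⟨⟨s, hs1, hs2⟩, t, ht1, ht2⟩ := h
  rcases le_total s t with hst | hst
  · exact ht2 (filledAfter_mono Y G B hst hs1)
  · exact hs2 (filledAfter_mono Y G B hst ht1)

/-- Filling the endpoint of an edge that is filled later makes the edge irrelevant. -/
lemma filledAfter_subset_of_adj_iff {Y : Param} {G H : SimpleGraph V} {u v : V}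
    (hGH : ∀ a b, s(a, b) ≠ s(u, v) → (G.Adj a b ↔ H.Adj a b)) {B : Set V}
    (hvu : ∀ t, v ∈ filledAfter Y G B t → u ∈ filledAfter Y G B t) (t : ℕ) :
    insert v (filledAfter Y G B t) ⊆ filledAfter Y H (insert v B) t := by
  induction t with
  | zero => exact subset_rfl
  | succ t ih =>
    refine Set.insert_subset (filledAfter_mono _ _ _ (Nat.zero_le _) (Set.mem_insert v B)) ?_
    intro w hw
    rw [filledAfter_succ, mem_step] at hw ⊢
    have hvT := ih (Set.mem_insert _ _)
    replace ih := (Set.subset_insert _ _).trans ih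
    specialize hvu t
    generalize filledAfter Y G B t = S at *
    generalize filledAfter Y H (insert v B) t = T at *
    by_cases hwT : w ∈ T
    · exact Or.inl hwT
    rcases hw with hw | ⟨x, hx, hxw, h⟩
    · exact Or.inl (ih hw)
    -- No edge from a vertex of `S` to one outside `T` is `uv`: the outer end is not `v`, and if it
    -- were `u`, then `v ∈ S` would give `u ∈ S`.
    have hmiss : ∀ a b, a ∈ S → b ∉ T → s(a, b) ≠ s(u, v) := by
      intro a b ha hb hab
      rcases Sym2.eq_iff.1 hab with ⟨rfl, rfl⟩ | ⟨rfl, rfl⟩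
      · exact hb hvT
      · exact hb (ih (hvu ha))
    refine Or.inr ⟨x, ih hx, (hGH _ _ (hmiss _ _ hx hwT)).1 hxw, fun y hy hb hxy =>
      h y (fun hyS => hy (ih hyS)) ?_ ((hGH _ _ (hmiss _ _ hx hy)).2 hxy)⟩
    refine hb.map id (fun a b ha hb hab => .single ⟨(hGH _ _ ?_).2 hab, fun h => hb (ih h)⟩) hwT
    intro hab
    rcases Sym2.eq_iff.1 hab with ⟨rfl, rfl⟩ | ⟨rfl, rfl⟩
    · exact hb hvT
    · exact ha hvT

/-- The hypothesis is symmetric in `G` and `H`, so this serves for deleting an edge as well as for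
restoring it. -/
lemma exists_filling_of_adj_iff {Y : Param} {G H : SimpleGraph V} {u v : V}
    (hGH : ∀ a b, s(a, b) ≠ s(u, v) → (G.Adj a b ↔ H.Adj a b)) {B : Set V} {t : ℕ}
    (hB : filledAfter Y G B t = Set.univ) :
    ∃ B' : Set V, B'.Nonempty ∧ B'.ncard ≤ B.ncard + 1 ∧ filledAfter Y H B' t = Set.univ := by
  have key : ∀ u v, (∀ a b, s(a, b) ≠ s(u, v) → (G.Adj a b ↔ H.Adj a b)) →
      (∀ t, v ∈ filledAfter Y G B t → u ∈ filledAfter Y G B t) →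
      ∃ B' : Set V, B'.Nonempty ∧ B'.ncard ≤ B.ncard + 1 ∧ filledAfter Y H B' t = Set.univ := by
    intro u v hGH h
    refine ⟨insert v B, Set.insert_nonempty _ _, Set.ncard_insert_le _ _,
      Set.univ_subset_iff.1 ?_⟩
    rw [← hB]
    exact (Set.subset_insert _ _).trans (filledAfter_subset_of_adj_iff hGH h t)
  rcases subset_or_subset_of_filledAfter Y G B u v with h | h
  · exact key u v hGH h
  · exact key v u (fun a b hab => hGH a b (by rwa [Sym2.eq_swap (a := u)])) h

lemma deleteEdge_adj_iff (G : SimpleGraph V) (e : Sym2 V) (a b : V) :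
    (deleteEdge G e).Adj a b ↔ G.Adj a b ∧ s(a, b) ≠ e := by
  simp [deleteEdge]

/-- Once `x` is filled from the start, it neither blocks a force nor lies on a walk through unfilled
vertices. -/
lemma exists_filling_deleteVertex {Y : Param} {G : SimpleGraph V} {x : V}
    {B : Set ({x}ᶜ : Set V)} (hne : B.Nonempty) {t : ℕ}
    (hB : filledAfter Y (deleteVertex G x) B t = Set.univ) :
    ∃ B' : Set V, B'.Nonempty ∧ B'.ncard ≤ B.ncard + 1 ∧ filledAfter Y G B' t = Set.univ := by
  classical
  have key : ∀ t, insert x (Subtype.val '' filledAfter Y (deleteVertex G x) B t) ⊆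
      filledAfter Y G (insert x (Subtype.val '' B)) t := by
    intro t
    induction t with
    | zero => exact subset_rfl
    | succ t ih =>
      refine Set.insert_subset (filledAfter_mono _ _ _ (Nat.zero_le _) (Set.mem_insert x _)) ?_
      rintro _ ⟨w, hw, rfl⟩
      rw [filledAfter_succ, mem_step] at hw ⊢
      have hxT := ih (Set.mem_insert _ _)
      replace ih := (Set.subset_insert _ _).trans ih
      generalize filledAfter Y (deleteVertex G x) B t = S at *
      generalize filledAfter Y G (insert x (Subtype.val '' B)) t = T at *
      by_cases hwT : w.1 ∈ T
      · exact Or.inl hwT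
      rcases hw with hw | ⟨v, hv, hvw, h⟩
      · exact Or.inl (ih ⟨w, hw, rfl⟩)
      obtain ⟨b₀, -⟩ := hne
      -- The default `b₀` is the value at `x`, which is filled and so never matters.
      let φ : V → ({x}ᶜ : Set V) := fun a => if ha : a ∈ ({x}ᶜ : Set V) then ⟨a, ha⟩ else b₀
      have hφ : ∀ a : ({x}ᶜ : Set V), φ a.1 = a := fun a => dif_pos a.2
      have hne : ∀ a, a ∉ T → ∃ a' : ({x}ᶜ : Set V), a'.1 = a ∧ a' ∉ S := fun a ha =>
        ⟨⟨a, fun hax => ha (Set.mem_singleton_iff.1 hax ▸ hxT)⟩, rfl, fun hS => ha (ih ⟨_, hS, rfl⟩)⟩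
      refine Or.inr ⟨v, ih ⟨v, hv, rfl⟩, hvw, fun y hy hb hvy => ?_⟩
      obtain ⟨y, rfl, hyS⟩ := hne y hy
      refine congrArg Subtype.val (h y hyS ?_ hvy)
      rw [← hφ w, ← hφ y]
      refine hb.map φ (fun a b ha hb hab => ?_) hwT
      obtain ⟨a, rfl, haS⟩ := hne a ha
      obtain ⟨b, rfl, hbS⟩ := hne b hb
      rw [hφ, hφ]
      exact .single ⟨hab, hbS⟩
  refine ⟨insert x (Subtype.val '' B), Set.insert_nonempty _ _, ?_, Set.eq_univ_of_forall ?_⟩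
  · refine (Set.ncard_insert_le _ _).trans ?_
    rw [Set.ncard_image_of_injective _ Subtype.val_injective]
  · intro y
    refine key t ?_
    rw [hB]
    by_cases hy : y = x
    · exact Or.inl hy
    · exact Or.inr ⟨⟨y, hy⟩, trivial, rfl⟩

end Bounds

/-! ### Contracting an edge -/

section Contraction

variable {V : Type*}

lemma contractEdge_adj_iff {G : SimpleGraph V} {e : Sym2 V}
    {p q : Quotient (endpointSetoid e)} :
    (contractEdge G e).Adj p q ↔ p ≠ q ∧ ∃ a b, G.Adj a b ∧
      Quotient.mk (endpointSetoid e) a = p ∧ Quotient.mk (endpointSetoid e) b = q :=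
  SimpleGraph.map_adj' _ G p q

lemma contractEdge_mk_eq_iff {e : Sym2 V} {a b : V} :
    Quotient.mk (endpointSetoid e) a = Quotient.mk (endpointSetoid e) b ↔
      a = b ∨ (a ∈ e ∧ b ∈ e) :=
  Quotient.eq (r := endpointSetoid e)

/-- Applied with `v` filled in advance: unfilled vertices are then determined by their classes. -/
lemma contractEdge_mk_injOn {u v : V} {a b : V}
    (h : Quotient.mk (endpointSetoid s(u, v)) a = Quotient.mk (endpointSetoid s(u, v)) b)
    (ha : a ≠ v) (hb : b ≠ v) : a = b := by
  rcases contractEdge_mk_eq_iff.1 h with h | ⟨h1, h2⟩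
  · exact h
  · simp only [Sym2.mem_iff] at h1 h2
    rw [h1.resolve_right ha, h2.resolve_right hb]

/-- If the merged vertex is filled through a neighbor of `u`, then filling `v` in advance lets the
process of the contraction run in the original graph. -/
lemma insert_preimage_subset_filledAfter {Y : Param} {G : SimpleGraph V} {u v : V}
    {B : Set (Quotient (endpointSetoid s(u, v)))}
    (hu : ∀ t, let S := filledAfter Y (contractEdge G s(u, v)) B t
      Quotient.mk _ u ∉ S → Quotient.mk _ u ∈ step Y (contractEdge G s(u, v)) t S →
      ∃ x, Quotient.mk _ x ∈ S ∧ G.Adj x u ∧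
        ∀ y ∉ S, Blocks Y (contractEdge G s(u, v)) t S (Quotient.mk _ u) y →
          (contractEdge G s(u, v)).Adj (Quotient.mk _ x) y → y = Quotient.mk _ u) (t : ℕ) :
    insert v (Quotient.mk _ ⁻¹' filledAfter Y (contractEdge G s(u, v)) B t) ⊆
      filledAfter Y G (insert v (Quotient.mk _ ⁻¹' B)) t := by
  induction t with
  | zero => exact subset_rfl
  | succ t ih =>
    refine Set.insert_subset (filledAfter_mono _ _ _ (Nat.zero_le _) (Set.mem_insert v _)) ?_
    intro w hw
    rw [Set.mem_preimage, filledAfter_succ] at hw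
    rw [filledAfter_succ, mem_step]
    specialize hu t
    have hvT := ih (Set.mem_insert _ _)
    replace ih := (Set.subset_insert _ _).trans ih
    dsimp only at hu
    generalize filledAfter Y (contractEdge G s(u, v)) B t = S at *
    generalize filledAfter Y G (insert v (Quotient.mk _ ⁻¹' B)) t = T at *
    by_cases hwT : w ∈ T
    · exact Or.inl hwT
    have hwS : Quotient.mk _ w ∉ S := fun h => hwT (ih h)
    have hwv : w ≠ v := fun h => hwT (h ▸ hvT)
    obtain ⟨x, hx, hxw, h⟩ : ∃ x, Quotient.mk _ x ∈ S ∧ G.Adj x w ∧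
        ∀ y ∉ S, Blocks Y (contractEdge G s(u, v)) t S (Quotient.mk _ w) y →
          (contractEdge G s(u, v)).Adj (Quotient.mk _ x) y → y = Quotient.mk _ w := by
      by_cases hwu : w = u
      · subst hwu
        exact hu hwS hw
      -- The class of `w` is a singleton here, so the filling edge lifts to an edge that ends in
      -- `w`.
      · obtain ⟨x, hx, hxw, h⟩ := (mem_step.1 hw).resolve_left hwS
        obtain ⟨-, a, b, hab, rfl, hb⟩ := contractEdge_adj_iff.1 hxw
        rcases contractEdge_mk_eq_iff.1 hb with rfl | ⟨-, hb⟩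
        · exact ⟨a, hx, hab, h⟩
        · simp [hwu, hwv] at hb
    refine Or.inr ⟨x, ih hx, hxw, fun y hy hb hxy => ?_⟩
    have hyS : Quotient.mk _ y ∉ S := fun h => hy (ih h)
    refine contractEdge_mk_injOn (h _ hyS ?_ ?_) (fun h => hy (h ▸ hvT)) hwv
    · refine hb.map (Quotient.mk _) (fun a b ha hb hab => ?_) hwT
      by_cases hab' : Quotient.mk (endpointSetoid s(u, v)) a = Quotient.mk _ b
      · rw [hab']
      · exact .single ⟨contractEdge_adj_iff.2 ⟨hab', a, b, hab, rfl, rfl⟩, fun h => hb (ih h)⟩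
    · exact contractEdge_adj_iff.2 ⟨fun h => hyS (h ▸ hx), x, y, hxy, rfl, rfl⟩

/-- The merged vertex is filled along the image of an edge of `G` that ends in one endpoint of `e`.
That endpoint can be filled in the same way in `G`, so the other one is added in advance. If the
merged vertex is never newly filled, either choice works. -/
lemma exists_filling_of_contractEdge [Finite V] {Y : Param} {G : SimpleGraph V} {e : Sym2 V}
    {B : Set (Quotient (endpointSetoid e))} {t : ℕ}
    (hB : filledAfter Y (contractEdge G e) B t = Set.univ) :
    ∃ B' : Set V, B'.Nonempty ∧ B'.ncard ≤ B.ncard + 1 ∧ filledAfter Y G B' t = Set.univ := by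
  have key : ∃ a b, e = s(a, b) ∧ ∀ t, let S := filledAfter Y (contractEdge G e) B t
      Quotient.mk (endpointSetoid e) a ∉ S →
        Quotient.mk _ a ∈ step Y (contractEdge G e) t S →
      ∃ x, Quotient.mk _ x ∈ S ∧ G.Adj x a ∧
        ∀ y ∉ S, Blocks Y (contractEdge G e) t S (Quotient.mk _ a) y →
          (contractEdge G e).Adj (Quotient.mk _ x) y → y = Quotient.mk _ a := by
    obtain ⟨u, hu⟩ : ∃ u, u ∈ e := ⟨_, e.out_fst_mem⟩
    by_cases hex : ∃ t, Quotient.mk _ u ∉ filledAfter Y (contractEdge G e) B t ∧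
        Quotient.mk _ u ∈ filledAfter Y (contractEdge G e) B (t + 1)
    · obtain ⟨t, ht1, ht2⟩ := hex
      obtain ⟨x, hx, hxw, h⟩ := (mem_step.1 ht2).resolve_left ht1
      obtain ⟨-, a, b, hab, rfl, hb⟩ := contractEdge_adj_iff.1 hxw
      have hbe : b ∈ e := by
        rcases contractEdge_mk_eq_iff.1 hb with rfl | ⟨hb, -⟩
        · exact hu
        · exact hb
      obtain ⟨c, hc⟩ := hbe
      refine ⟨b, c, hc, fun s hs1 hs2 => ?_⟩
      rw [hb] at hs1 hs2 ⊢
      -- A vertex is newly filled at most once.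
      have hst : s = t := by
        rcases lt_trichotomy s t with hst | hst | hst
        · exact absurd (filledAfter_mono Y _ B (Nat.succ_le_of_lt hst) hs2) ht1
        · exact hst
        · exact absurd (filledAfter_mono Y _ B (Nat.succ_le_of_lt hst) ht2) hs1
      subst hst
      exact ⟨a, hx, hab, h⟩
    · push Not at hex
      obtain ⟨v, hv⟩ := hu
      exact ⟨u, v, hv, fun t h1 h2 => absurd h2 (hex t h1)⟩
  obtain ⟨u, v, rfl, h⟩ := key
  refine ⟨insert v (Quotient.mk _ ⁻¹' B), Set.insert_nonempty _ _, ?_, Set.univ_subset_iff.1 ?_⟩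
  -- The preimage of `B` may contain both endpoints; without `v` it injects into `B`.
  · rw [← Set.insert_sdiff_singleton]
    refine (Set.ncard_insert_le _ _).trans (Nat.add_le_add_right ?_ 1)
    exact Set.ncard_le_ncard_of_injOn (Quotient.mk _) (fun a ha => ha.1)
      (fun a ha b hb hab => contractEdge_mk_injOn hab ha.2 hb.2)
  · refine subset_trans ?_ (insert_preimage_subset_filledAfter h t)
    rw [hB]
    exact fun _ _ => Or.inr trivial

/-- The merged vertex dominates everything that the endpoints of the edge can fill. -/
lemma exists_filling_contractEdge_powerDomination [Finite V] {G : SimpleGraph V}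
    {u v : V} {B : Set V} {t : ℕ}
    (hB : filledAfter .powerDomination G B t = Set.univ) :
    ∃ B' : Set (Quotient (endpointSetoid s(u, v))), B'.Nonempty ∧ B'.ncard ≤ B.ncard + 1 ∧
      filledAfter .powerDomination (contractEdge G s(u, v)) B' t = Set.univ := by
  set p := Quotient.mk (endpointSetoid s(u, v)) u with hp
  have hpe : ∀ a, Quotient.mk (endpointSetoid s(u, v)) a = p ↔ a ∈ s(u, v) := by
    intro a
    rw [hp, contractEdge_mk_eq_iff]
    constructor
    · rintro (rfl | h)
      · exact Sym2.mem_mk_left _ _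
      · exact h.1
    · exact fun h => Or.inr ⟨h, Sym2.mem_mk_left _ _⟩
  have key : ∀ t, insert p (Quotient.mk _ '' filledAfter .powerDomination G B t) ⊆
      filledAfter .powerDomination (contractEdge G s(u, v)) (insert p (Quotient.mk _ '' B)) t := by
    intro t
    induction t with
    | zero => exact subset_rfl
    | succ t ih =>
      refine Set.insert_subset (filledAfter_mono _ _ _ (Nat.zero_le _) (Set.mem_insert p _)) ?_
      have hN : ∀ q, (contractEdge G s(u, v)).Adj p q →
          q ∈ filledAfter .powerDomination (contractEdge G s(u, v))
            (insert p (Quotient.mk _ '' B)) (t + 1) := by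
        intro q hq
        refine filledAfter_mono _ _ _ (Nat.le_add_left 1 t) (mem_step.2 (Or.inr ?_))
        exact ⟨p, Set.mem_insert _ _, hq, fun x _ h => h.elim⟩
      rintro _ ⟨w, hw, rfl⟩
      by_contra hwT'
      have hwp : ¬ (contractEdge G s(u, v)).Adj p (Quotient.mk _ w) := fun h => hwT' (hN _ h)
      rw [filledAfter_succ, mem_step] at hwT' hw
      have hpT := ih (Set.mem_insert _ _)
      replace ih := (Set.subset_insert _ _).trans ih
      obtain ⟨hwT, hwT'⟩ := not_or.1 hwT'
      rcases hw with hw | ⟨x, hx, hxw, h⟩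
      · exact hwT (ih ⟨w, hw, rfl⟩)
      have hne : Quotient.mk (endpointSetoid s(u, v)) x ≠ Quotient.mk _ w :=
        fun h => hwT (ih ⟨x, hx, h⟩)
      have hadj := (contractEdge_adj_iff (G := G)).2 ⟨hne, x, w, hxw, rfl, rfl⟩
      refine hwT' ⟨Quotient.mk _ x, ih ⟨x, hx, rfl⟩, hadj, fun y hy hb hxy => ?_⟩
      match t with
      | 0 => exact hb.elim
      | t + 1 =>
        -- The filling vertex is not an endpoint of `e`, since all neighbors of the merged vertex
        -- were filled in the first step.
        by_cases hxp : Quotient.mk _ x = p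
        · exact absurd (hxp ▸ hadj) hwp
        obtain ⟨-, a, b, hab, ha, rfl⟩ := contractEdge_adj_iff.1 hxy
        rcases contractEdge_mk_eq_iff.1 ha with rfl | ⟨-, ha⟩
        · rw [h b (fun hb => hy (ih ⟨b, hb, rfl⟩)) trivial hab]
        · exact absurd ((hpe x).2 ha) hxp
  refine ⟨insert p (Quotient.mk _ '' B), Set.insert_nonempty _ _, ?_, Set.eq_univ_of_forall ?_⟩
  · refine (Set.ncard_insert_le _ _).trans (Nat.add_le_add_right ?_ 1)
    exact Set.ncard_image_le
  · intro q
    induction q using Quotient.inductionOn with | h a => ?_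
    refine key t (Or.inr ⟨a, ?_, rfl⟩)
    rw [hB]
    trivial

end Contraction

/-! ### Subdividing an edge -/

section Subdivision

variable {V : Type*}

lemma Blocks.head {Y : Param} {G : SimpleGraph V} {t : ℕ} {S : Set V} {a b c : V}
    (hab : G.Adj a b) (hb : b ∉ S) (h : Blocks Y G t S b c) : Blocks Y G t S a c := by
  match Y, t with
  | .powerDomination, 0 => exact h
  | .powerDomination, _ + 1 => trivial
  | .psdForcing, _ => exact Relation.ReflTransGen.head ⟨hab, hb⟩ h

lemma Blocks.tail {Y : Param} {G : SimpleGraph V} {t : ℕ} {S : Set V} {a b c : V}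
    (h : Blocks Y G t S a b) (hbc : G.Adj b c) (hc : c ∉ S) : Blocks Y G t S a c := by
  match Y, t with
  | .powerDomination, 0 => exact h
  | .powerDomination, _ + 1 => trivial
  | .psdForcing, _ => exact Relation.ReflTransGen.tail h ⟨hbc, hc⟩

/-- The new vertex, filled in advance, fills both endpoints of `e` in the first step. No force along
`e` is needed after that, and the new vertex blocks nothing. -/
lemma exists_filling_subdivideEdge_powerDomination [Finite V] {G : SimpleGraph V} {e : Sym2 V}
    {B : Set V} {t : ℕ} (hB : filledAfter .powerDomination G B t = Set.univ) :
    ∃ B' : Set (Option V), B'.Nonempty ∧ B'.ncard ≤ B.ncard + 1 ∧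
      filledAfter .powerDomination (subdivideEdge G e) B' t = Set.univ := by
  have key : ∀ t, insert none (some '' filledAfter .powerDomination G B t) ⊆
      filledAfter .powerDomination (subdivideEdge G e) (insert none (some '' B)) t := by
    intro t
    induction t with
    | zero => exact subset_rfl
    | succ t ih =>
      refine Set.insert_subset (filledAfter_mono _ _ _ (Nat.zero_le _) (Set.mem_insert _ _)) ?_
      have he : ∀ w ∈ e, some w ∈ filledAfter .powerDomination (subdivideEdge G e)
            (insert none (some '' B)) (t + 1) := by
        intro w hw
        refine filledAfter_mono _ _ _ (Nat.le_add_left 1 t) (mem_step.2 (Or.inr ?_))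
        exact ⟨none, Set.mem_insert _ _, hw, fun x _ h => h.elim⟩
      rintro _ ⟨w, hw, rfl⟩
      by_cases hwe : w ∈ e
      · exact he w hwe
      rw [filledAfter_succ, mem_step] at hw ⊢
      have hT := ih (Set.mem_insert _ _)
      replace ih := (Set.subset_insert _ _).trans ih
      rcases hw with hw | ⟨x, hx, hxw, h⟩
      · exact Or.inl (ih ⟨w, hw, rfl⟩)
      have hne : s(x, w) ≠ e := fun h => hwe (h ▸ Sym2.mem_mk_right _ _)
      refine Or.inr ⟨some x, ih ⟨x, hx, rfl⟩, ⟨hxw, hne⟩, fun y hy hb hxy => ?_⟩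
      match t, y with
      | 0, _ => exact hb.elim
      | t + 1, none => exact absurd hT hy
      | t + 1, some y => rw [h y (fun hyS => hy (ih ⟨y, hyS, rfl⟩)) trivial hxy.1]
  refine ⟨_, Set.insert_nonempty none (some '' B), ?_, Set.eq_univ_of_forall ?_⟩
  · refine (Set.ncard_insert_le _ _).trans (Nat.add_le_add_right Set.ncard_image_le 1)
  · intro y
    refine key t ?_
    rw [hB]
    cases y <;> simp

lemma exists_eq_mk_of_mem {e : Sym2 V} {x : V} (h : x ∈ e) : ∃ y, e = s(x, y) := h

/-- Walks through unfilled vertices of the subdivision project to the original graph; the new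
vertex is sent to an unfilled endpoint of the edge. -/
lemma Blocks.of_subdivideEdge {Y : Param} {G : SimpleGraph V} {e : Sym2 V} (he : e ∈ G.edgeSet)
    {t : ℕ} {S : Set V} {T : Set (Option V)} (hST : ∀ a, some a ∈ T ↔ a ∈ S) {x : V}
    (hx : x ∈ e) (hxS : x ∉ S ∨ ∀ a ∈ e, a ∈ S) {a b : Option V} (ha : a ∉ T)
    (h : Blocks Y (subdivideEdge G e) t T a b) : Blocks Y G t S (a.getD x) (b.getD x) := by
  obtain ⟨y, rfl⟩ := exists_eq_mk_of_mem hx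
  have hxy : G.Adj x y := he
  refine h.map (fun a => a.getD x) (fun a b ha hb hab => ?_) ha
  match a, b with
  | some a, some b => exact .single ⟨hab.1, fun h => hb ((hST b).2 h)⟩
  | none, some b =>
    have hbS : b ∉ S := fun h => hb ((hST b).2 h)
    have hbe : b ∈ s(x, y) := hab
    rcases Sym2.mem_iff.1 hbe with rfl | rfl
    · exact .refl
    · exact .single ⟨hxy, hbS⟩
  | some a, none =>
    have haS : a ∉ S := fun h => ha ((hST a).2 h)
    have hae : a ∈ s(x, y) := hab
    rcases Sym2.mem_iff.1 hae with rfl | rfl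
    · exact .refl
    -- The walk enters the new vertex from an unfilled endpoint, so not all endpoints are filled and
    -- `x` is unfilled.
    · exact .single ⟨hxy.symm, hxS.resolve_right fun h => haS (h _ hae)⟩

lemma exists_endpoint (e : Sym2 V) (S : Set V) : ∃ x ∈ e, x ∉ S ∨ ∀ a ∈ e, a ∈ S := by
  by_cases h : ∃ x ∈ e, x ∉ S
  · obtain ⟨x, hx, h⟩ := h
    exact ⟨x, hx, Or.inl h⟩
  · push Not at h
    exact ⟨_, e.out_fst_mem, Or.inr h⟩

/-- If the new vertex is unfilled and both its neighbors are filled, then it can be filled. -/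
lemma none_mem_step_psdForcing {G : SimpleGraph V} {e : Sym2 V} {t : ℕ} {S : Set V}
    (h : ∀ a ∈ e, a ∈ S) : none ∈ step .psdForcing (subdivideEdge G e) t (some '' S) := by
  refine mem_step.2 (Or.inr ⟨some e.out.1, ⟨_, h _ e.out_fst_mem, rfl⟩, e.out_fst_mem,
    fun y hy hb _ => ?_⟩)
  rcases Relation.ReflTransGen.cases_head hb with h0 | ⟨c, ⟨hc, hcT⟩, -⟩
  · exact h0.symm
  · match c with
    | some c => exact absurd ⟨c, h c hc, rfl⟩ hcT

/-- Any force of `G` that fails in the subdivision makes the new vertex fillable. If it runs along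
`e`, its source fills the new vertex instead. If the new vertex blocks it, the source is an endpoint
of `e`. The other endpoint is then filled, since an unfilled one would already block the force in
`G`; with both endpoints filled, the new vertex can be filled. -/
lemma image_step_subset_of_none_notMem {G : SimpleGraph V} {e : Sym2 V} (he : e ∈ G.edgeSet)
    {t : ℕ} {S : Set V} (hn : none ∉ step .psdForcing (subdivideEdge G e) t (some '' S)) :
    some '' step .psdForcing G t S ⊆ step .psdForcing (subdivideEdge G e) t (some '' S) := by
  have hST : ∀ a, some a ∈ some '' S ↔ a ∈ S := fun a => by simp
  rintro _ ⟨w, hw, rfl⟩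
  by_cases hwS : w ∈ S
  · exact subset_step _ _ _ _ ⟨w, hwS, rfl⟩
  have hwT : some w ∉ some '' S := fun h => hwS ((hST w).1 h)
  obtain ⟨x, hx, hxw, h⟩ := (mem_step.1 hw).resolve_left hwS
  by_cases hxe : s(x, w) = e
  · subst hxe
    refine absurd (mem_step.2 (Or.inr ⟨some x, (hST x).2 hx, Sym2.mem_mk_left x w,
      fun y hy hb hxy => ?_⟩)) hn
    match y with
    | none => rfl
    | some y =>
      have := h y (fun h => hy ((hST y).2 h)) (hb.of_subdivideEdge he hST (Sym2.mem_mk_right _ _)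
        (Or.inl hwS) (by simp)) hxy.1
      exact absurd (by rw [this]) hxy.2
  · refine mem_step.2 (Or.inr ⟨some x, ⟨x, hx, rfl⟩, ⟨hxw, hxe⟩, fun y hy hb hxy => ?_⟩)
    match y with
    | some y =>
      obtain ⟨z, hz, hzS⟩ := exists_endpoint e S
      rw [h y (fun h => hy ((hST y).2 h)) (hb.of_subdivideEdge he hST hz hzS hwT) hxy.1]
    | none =>
      exfalso
      obtain ⟨z, rfl⟩ := exists_eq_mk_of_mem (show x ∈ e from hxy)
      by_cases hzS : z ∈ S
      · refine hn (none_mem_step_psdForcing fun a ha => ?_)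
        rcases Sym2.mem_iff.1 ha with rfl | rfl <;> assumption
      · have := h z hzS (hb.of_subdivideEdge he hST (Sym2.mem_mk_right _ _) (Or.inl hzS) hwT) he
        exact hxe (this ▸ rfl)

/-- A force along `e` is taken over by the new vertex, whose other neighbor is filled; a filled new
vertex cannot disturb the remaining forces. -/
lemma image_step_subset_insert_none {G : SimpleGraph V} {e : Sym2 V} (he : e ∈ G.edgeSet)
    {t : ℕ} {S : Set V} :
    some '' step .psdForcing G t S ⊆
      step .psdForcing (subdivideEdge G e) t (insert none (some '' S)) := by
  have hST : ∀ a, some a ∈ insert none (some '' S) ↔ a ∈ S := fun a => by simp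
  rintro _ ⟨w, hw, rfl⟩
  by_cases hwS : w ∈ S
  · exact subset_step _ _ _ _ ((hST w).2 hwS)
  have hwT : some w ∉ insert none (some '' S) := fun h => hwS ((hST w).1 h)
  obtain ⟨x, hx, hxw, h⟩ := (mem_step.1 hw).resolve_left hwS
  by_cases hxe : s(x, w) = e
  · subst hxe
    refine mem_step.2 (Or.inr ⟨none, Set.mem_insert _ _, Sym2.mem_mk_right _ _,
      fun y hy hb hxy => ?_⟩)
    match y with
    | some y =>
      have hy : y ∉ S := fun h => hy ((hST y).2 h)
      have hye : y ∈ s(x, w) := hxy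
      rcases Sym2.mem_iff.1 hye with rfl | rfl
      · exact absurd hx hy
      · rfl
  · refine mem_step.2 (Or.inr ⟨some x, (hST x).2 hx, ⟨hxw, hxe⟩, fun y hy hb hxy => ?_⟩)
    match y with
    | none => exact absurd (Set.mem_insert _ _) hy
    | some y =>
      obtain ⟨z, hz, hzS⟩ := exists_endpoint e S
      rw [h y (fun h => hy ((hST y).2 h)) (hb.of_subdivideEdge he hST hz hzS hwT) hxy.1]

/-- Subdividing an edge delays positive semidefinite forcing by at most one time step. -/
lemma filledAfter_subdivideEdge_psdForcing {G : SimpleGraph V} {e : Sym2 V} (he : e ∈ G.edgeSet)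
    {B : Set V} {t : ℕ} (hB : filledAfter .psdForcing G B t = Set.univ) :
    filledAfter .psdForcing (subdivideEdge G e) (some '' B) (t + 1) = Set.univ := by
  classical
  have hex : ∃ s, none ∈ step .psdForcing (subdivideEdge G e) s
      (some '' filledAfter .psdForcing G B s) :=
    ⟨t, none_mem_step_psdForcing fun a _ => hB ▸ trivial⟩
  -- The two processes run in step until the new vertex can be filled; one time step is spent on it,
  -- and `h2` keeps this delay of one from then on.
  have h1 : ∀ i ≤ Nat.find hex, some '' filledAfter .psdForcing G B i ⊆
      filledAfter .psdForcing (subdivideEdge G e) (some '' B) i := by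
    intro i
    induction i with
    | zero => exact fun _ => subset_rfl
    | succ i ih =>
      intro hi
      exact (image_step_subset_of_none_notMem he (Nat.find_min hex hi)).trans
        (step_mono (ih (by omega)))
  have h2 : ∀ i, Nat.find hex ≤ i → insert none (some '' filledAfter .psdForcing G B i) ⊆
      filledAfter .psdForcing (subdivideEdge G e) (some '' B) (i + 1) := by
    intro i hi
    induction i, hi using Nat.le_induction with
    | base =>
      refine Set.insert_subset (step_mono (h1 _ le_rfl) (Nat.find_spec hex)) ?_
      exact (h1 _ le_rfl).trans (subset_step _ _ _ _)
    | succ i hi ih =>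
      refine Set.insert_subset (subset_step _ _ _ _ (ih (Set.mem_insert _ _))) ?_
      exact (image_step_subset_insert_none (t := i + 1) he).trans (step_mono ih)
  have h3 := h2 t (Nat.find_le (n := t) (none_mem_step_psdForcing fun a _ => hB ▸ trivial))
  refine Set.eq_univ_of_forall fun y => h3 ?_
  rw [hB]
  cases y <;> simp

/-- If the new vertex is not filled initially, then the process of the subdivision runs in the
original graph. -/
lemma subset_filledAfter_of_none_notMem {Y : Param} {G : SimpleGraph V} {e : Sym2 V}
    (he : e ∈ G.edgeSet) {B : Set (Option V)} (hB : none ∉ B) (t : ℕ) :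
    -- The second part of the invariant matches the filling of the new vertex from one endpoint with
    -- the filling of the other endpoint in `G`.
    (∀ a, some a ∈ filledAfter Y (subdivideEdge G e) B t →
        a ∈ filledAfter Y G (some ⁻¹' B) t) ∧
      (none ∈ filledAfter Y (subdivideEdge G e) B t →
        ∀ a ∈ e, a ∈ filledAfter Y G (some ⁻¹' B) t) := by
  induction t with
  | zero => exact ⟨fun a ha => ha, fun h => absurd h hB⟩
  | succ t ih =>
    simp only [filledAfter_succ]
    generalize filledAfter Y (subdivideEdge G e) B t = T at *
    generalize filledAfter Y G (some ⁻¹' B) t = S at *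
    obtain ⟨ih, ihn⟩ := ih
    have hmap : ∀ {a b}, a ∉ S → Blocks Y G t S a b →
        Blocks Y (subdivideEdge G e) t T (some a) (some b) := by
      intro a b ha hab
      refine hab.map some (fun c d hc hd hcd => ?_) ha
      by_cases hcde : s(c, d) = e
      · subst hcde
        -- The edge `e` is replaced by the detour through the new vertex, which is unfilled because
        -- `d` is.
        refine Relation.ReflTransGen.tail (b := none) (.single ⟨Sym2.mem_mk_left _ _, ?_⟩)
          ⟨Sym2.mem_mk_right _ _, fun h => hd (ih d h)⟩
        exact fun h => hd (ihn h d (Sym2.mem_mk_right _ _))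
      · exact .single ⟨⟨hcd, hcde⟩, fun h => hd (ih d h)⟩
    constructor
    · intro w hw
      by_cases hwS : w ∈ S
      · exact subset_step _ _ _ _ hwS
      obtain ⟨x, hx, hxw, h⟩ := (mem_step.1 hw).resolve_left fun h => hwS (ih w h)
      match x with
      | none => exact absurd (ihn hx w hxw) hwS
      | some x =>
        refine mem_step.2 (Or.inr ⟨x, ih x hx, hxw.1, fun y hy hb hxy => ?_⟩)
        have hyT : some y ∉ T := fun h => hy (ih y h)
        by_cases hxye : s(x, y) = e
        · subst hxye
          have hn : none ∉ T := fun h => hy (ihn h y (Sym2.mem_mk_right _ _))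
          have := h none hn ((hmap hwS hb).tail (Sym2.mem_mk_right x y) hn) (Sym2.mem_mk_left x y)
          simp at this
        · exact Option.some_injective _ (h (some y) hyT (hmap hwS hb) ⟨hxy, hxye⟩)
    · intro hw a ha
      by_cases hn : none ∈ T
      · exact subset_step _ _ _ _ (ihn hn a ha)
      obtain ⟨x, hx, hxw, h⟩ := (mem_step.1 hw).resolve_left hn
      match x with
      | some x =>
        obtain ⟨z, rfl⟩ := exists_eq_mk_of_mem (show x ∈ e from hxw)
        rcases Sym2.mem_iff.1 ha with rfl | rfl
        · exact subset_step _ _ _ _ (ih _ hx)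
        by_cases haS : a ∈ S
        · exact subset_step _ _ _ _ haS
        refine mem_step.2 (Or.inr ⟨x, ih x hx, he, fun y hy hb hxy => ?_⟩)
        by_contra hya
        have hyT : some y ∉ T := fun h => hy (ih y h)
        -- Another unfilled neighbor `y` of `x` would be joined to the new vertex through `a`, and
        -- `x` could not have filled the new vertex.
        have := h (some y) hyT ((hmap haS hb).head (show (subdivideEdge G s(x, a)).Adj none (some a)
            from Sym2.mem_mk_right x a) fun h => haS (ih _ h))
          ⟨hxy, fun h => hya ?_⟩
        · simp at this
        · exact Sym2.congr_right.1 h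

/-- If the new vertex is filled initially, it can be exchanged for the endpoint of the edge that
is filled later. -/
lemma subset_filledAfter_of_none_mem {Y : Param} {G : SimpleGraph V} {u v : V}
    (he : G.Adj u v) {B : Set (Option V)} (hB : none ∈ B)
    (hvu : ∀ t, some v ∈ filledAfter Y (subdivideEdge G s(u, v)) B t →
      some u ∈ filledAfter Y (subdivideEdge G s(u, v)) B t) (t : ℕ) :
    v ∈ filledAfter Y G (insert v (some ⁻¹' B)) t ∧
    ∀ a, some a ∈ filledAfter Y (subdivideEdge G s(u, v)) B t →
      a ∈ filledAfter Y G (insert v (some ⁻¹' B)) t := by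
  refine ⟨filledAfter_mono _ _ _ (Nat.zero_le t) (Set.mem_insert _ _), ?_⟩
  induction t with
  | zero => exact fun a ha => Or.inr ha
  | succ t ih =>
    have hvS : v ∈ filledAfter Y G (insert v (some ⁻¹' B)) t :=
      filledAfter_mono _ _ _ (Nat.zero_le t) (Set.mem_insert _ _)
    have hnT := filledAfter_mono Y (subdivideEdge G s(u, v)) B (Nat.zero_le t) hB
    simp only [filledAfter_succ]
    specialize hvu t
    generalize filledAfter Y (subdivideEdge G s(u, v)) B t = T at *
    generalize filledAfter Y G (insert v (some ⁻¹' B)) t = S at *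
    have hmap : ∀ {a b}, a ∉ S → Blocks Y G t S a b →
        Blocks Y (subdivideEdge G s(u, v)) t T (some a) (some b) := by
      intro a b ha hab
      refine hab.map some (fun c d hc hd hcd => ?_) ha
      refine .single ⟨(⟨hcd, fun h => ?_⟩ : G.Adj c d ∧ _), fun h => hd (ih d h)⟩
      rcases Sym2.eq_iff.1 h with ⟨rfl, rfl⟩ | ⟨rfl, rfl⟩
      · exact hd hvS
      · exact hc hvS
    intro w hw
    by_cases hwS : w ∈ S
    · exact subset_step _ _ _ _ hwS
    have hwT : some w ∉ T := fun h => hwS (ih w h)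
    obtain ⟨x, hx, hxw, h⟩ := (mem_step.1 hw).resolve_left hwT
    match x with
    | none =>
      have hwe : w ∈ s(u, v) := hxw
      rcases Sym2.mem_iff.1 hwe with rfl | rfl
      · have hvT : some v ∉ T := fun h => hwT (hvu h)
        -- The vertex `v` replaces the new vertex as the source. Another blocking neighbor `y` of
        -- `v` would connect the unfilled `v` to `w` in the subdivision, so `v` would have blocked
        -- the original force.
        refine mem_step.2 (Or.inr ⟨v, hvS, he.symm, fun y hy hb hvy => ?_⟩)
        by_contra hyw
        have hadj : (subdivideEdge G s(w, v)).Adj (some y) (some v) := by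
          refine ⟨hvy.symm, fun h => hyw ?_⟩
          exact Sym2.congr_left.1 h
        have := h (some v) hvT ((hmap hwS hb).tail hadj hvT) (Sym2.mem_mk_right w v)
        exact he.ne' (Option.some_injective _ this)
      · exact absurd hvS hwS
    | some x =>
      refine mem_step.2 (Or.inr ⟨x, ih x hx, hxw.1, fun y hy hb hxy => ?_⟩)
      have hyT : some y ∉ T := fun h => hy (ih y h)
      refine Option.some_injective _ (h (some y) hyT (hmap hwS hb) ⟨hxy, fun h => ?_⟩)
      rcases Sym2.eq_iff.1 h with ⟨rfl, rfl⟩ | ⟨rfl, rfl⟩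
      · exact hy hvS
      · exact hyT (hvu hx)

lemma exists_filling_of_subdivideEdge [Finite V] {Y : Param} {G : SimpleGraph V} {e : Sym2 V}
    (he : e ∈ G.edgeSet) {B : Set (Option V)} (hne : B.Nonempty) {t : ℕ}
    (hB : filledAfter Y (subdivideEdge G e) B t = Set.univ) :
    ∃ B' : Set V, B'.Nonempty ∧ B'.ncard ≤ B.ncard ∧ filledAfter Y G B' t = Set.univ := by
  have hcard : (some '' (some ⁻¹' B)).ncard = (some ⁻¹' B).ncard :=
    Set.ncard_image_of_injective _ (Option.some_injective V)
  by_cases hn : none ∈ B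
  · have key : ∀ u v, e = s(u, v) →
        (∀ t, some v ∈ filledAfter Y (subdivideEdge G e) B t →
          some u ∈ filledAfter Y (subdivideEdge G e) B t) →
        ∃ B' : Set V, B'.Nonempty ∧ B'.ncard ≤ B.ncard ∧ filledAfter Y G B' t = Set.univ := by
      rintro u v rfl h
      refine ⟨_, Set.insert_nonempty v (some ⁻¹' B), ?_, Set.eq_univ_of_forall fun a => ?_⟩
      · refine (Set.ncard_insert_le _ _).trans ?_
        rw [← hcard, ← Set.ncard_insert_of_notMem (a := (none : Option V)) (by simp)]
        refine Set.ncard_le_ncard (Set.insert_subset hn (Set.image_preimage_subset _ _))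
      · exact (subset_filledAfter_of_none_mem he hn h t).2 a (hB ▸ trivial)
    induction e with | h u v => ?_
    rcases subset_or_subset_of_filledAfter Y (subdivideEdge G s(u, v)) B (some u) (some v)
      with h | h
    · exact key u v rfl h
    · exact key v u Sym2.eq_swap h
  · refine ⟨some ⁻¹' B, ?_, ?_, Set.eq_univ_of_forall fun a => ?_⟩
    · obtain ⟨b, hb⟩ := hne
      match b with
      | none => exact absurd hb hn
      | some b => exact ⟨b, hb⟩
    · rw [← hcard]
      exact Set.ncard_le_ncard (Set.image_preimage_subset _ _)
    · exact (subset_filledAfter_of_none_notMem he hn t).1 a (hB ▸ trivial)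

end Subdivision

/-! ### The inequalities -/

section Inequalities

variable {V : Type*} {G : SimpleGraph V} {e : Sym2 V}

lemma HasEdge.of_deleteVertex {x : V} (h : HasEdge (deleteVertex G x)) : HasEdge G := by
  obtain ⟨u, v, huv⟩ := h.exists_adj
  exact ⟨s(u.1, v.1), huv⟩

variable (G e) in
lemma hasEdge_subdivideEdge : HasEdge (subdivideEdge G e) :=
  ⟨s(some e.out.1, none), e.out_fst_mem⟩

variable [Finite V]

lemma thStar_le_two_mul_deleteEdge (Y : Param) (he : e ∈ G.edgeSet)
    (h : HasEdge (deleteEdge G e)) : thStar Y G ≤ 2 * thStar Y (deleteEdge G e) := by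
  induction e with | h u v => ?_
  refine thStar_le_mul ⟨_, he⟩ h 1 fun B t _ hB => ?_
  exact exists_filling_of_adj_iff (u := u) (v := v)
    (fun a b hab => by simp [deleteEdge_adj_iff, hab]) hB

lemma thStar_deleteEdge_le_two_mul (Y : Param) (he : e ∈ G.edgeSet)
    (h : HasEdge (deleteEdge G e)) : thStar Y (deleteEdge G e) ≤ 2 * thStar Y G := by
  induction e with | h u v => ?_
  refine thStar_le_mul h ⟨_, he⟩ 1 fun B t _ hB => ?_
  exact exists_filling_of_adj_iff (u := u) (v := v)
    (fun a b hab => by simp [deleteEdge_adj_iff, hab]) hB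

variable (G e) in
lemma thTimes_le_two_mul_deleteEdge (Y : Param) :
    thTimes Y G ≤ 2 * thTimes Y (deleteEdge G e) := by
  induction e with | h u v => ?_
  refine thTimes_le_mul 1 fun B t _ hB => ?_
  exact exists_filling_of_adj_iff (u := u) (v := v)
    (fun a b hab => by simp [deleteEdge_adj_iff, hab]) hB

variable (G e) in
lemma thTimes_deleteEdge_le_two_mul (Y : Param) :
    thTimes Y (deleteEdge G e) ≤ 2 * thTimes Y G := by
  induction e with | h u v => ?_
  refine thTimes_le_mul 1 fun B t _ hB => ?_
  exact exists_filling_of_adj_iff (u := u) (v := v)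
    (fun a b hab => by simp [deleteEdge_adj_iff, hab]) hB

lemma thStar_le_two_mul_deleteVertex (Y : Param) {x : V} (h : HasEdge (deleteVertex G x)) :
    thStar Y G ≤ 2 * thStar Y (deleteVertex G x) :=
  thStar_le_mul h.of_deleteVertex h 1 fun _ _ hne hB => exists_filling_deleteVertex hne hB

variable (G) in
lemma thTimes_le_two_mul_deleteVertex (Y : Param) (x : V) :
    thTimes Y G ≤ 2 * thTimes Y (deleteVertex G x) :=
  thTimes_le_mul 1 fun _ _ hne hB => exists_filling_deleteVertex hne hB

lemma thStar_le_two_mul_contractEdge (Y : Param) (he : e ∈ G.edgeSet)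
    (h : HasEdge (contractEdge G e)) : thStar Y G ≤ 2 * thStar Y (contractEdge G e) :=
  thStar_le_mul ⟨e, he⟩ h 1 fun _ _ _ hB => exists_filling_of_contractEdge hB

variable (G e) in
lemma thTimes_le_two_mul_contractEdge (Y : Param) :
    thTimes Y G ≤ 2 * thTimes Y (contractEdge G e) :=
  thTimes_le_mul 1 fun _ _ _ hB => exists_filling_of_contractEdge hB

lemma thStar_contractEdge_le_two_mul (he : e ∈ G.edgeSet) (h : HasEdge (contractEdge G e)) :
    thStar .powerDomination (contractEdge G e) ≤ 2 * thStar .powerDomination G := by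
  induction e with | h u v => ?_
  exact thStar_le_mul h ⟨_, he⟩ 1 fun _ _ _ hB =>
    exists_filling_contractEdge_powerDomination hB

variable (G e) in
lemma thTimes_contractEdge_le_two_mul :
    thTimes .powerDomination (contractEdge G e) ≤ 2 * thTimes .powerDomination G := by
  induction e with | h u v => ?_
  exact thTimes_le_mul 1 fun _ _ _ hB => exists_filling_contractEdge_powerDomination hB

lemma thStar_le_subdivideEdge (Y : Param) (he : e ∈ G.edgeSet) :
    thStar Y G ≤ thStar Y (subdivideEdge G e) := by
  have := thStar_le_mul ⟨e, he⟩ (hasEdge_subdivideEdge G e) 0 fun _ _ hne hB =>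
    exists_filling_of_subdivideEdge (Y := Y) he hne hB
  simpa using this

lemma thTimes_le_subdivideEdge (Y : Param) (he : e ∈ G.edgeSet) :
    thTimes Y G ≤ thTimes Y (subdivideEdge G e) := by
  have := thTimes_le_mul 0 fun _ _ hne hB =>
    exists_filling_of_subdivideEdge (Y := Y) he hne hB
  simpa using this

lemma thTimes_subdivideEdge_le_two_mul :
    thTimes .powerDomination (subdivideEdge G e) ≤ 2 * thTimes .powerDomination G :=
  thTimes_le_mul 1 fun _ _ _ hB => exists_filling_subdivideEdge_powerDomination hB

lemma thStar_subdivideEdge_le_two_mul (Y : Param) (he : e ∈ G.edgeSet) :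
    thStar Y (subdivideEdge G e) ≤ 2 * thStar Y G := by
  match Y with
  | .powerDomination =>
    exact thStar_le_mul (hasEdge_subdivideEdge G e) ⟨e, he⟩ 1 fun _ _ _ hB =>
      exists_filling_subdivideEdge_powerDomination hB
  | .psdForcing =>
    by_cases htop : thStar .psdForcing G = ⊤
    · rw [htop]
      exact le_top
    obtain ⟨B, t, h1, h2, h3, h4⟩ := thStar_attained ⟨e, he⟩ htop
    refine (thStar_le (hasEdge_subdivideEdge G e) (h1.image some) (Nat.le_add_left 1 t)
      (filledAfter_subdivideEdge_psdForcing he h3)).trans ?_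
    rw [h4, Set.ncard_image_of_injective _ (Option.some_injective V), mul_left_comm]
    exact_mod_cast Nat.mul_le_mul_left _ (by omega)

/-- The delay of one step gives the factor `(p + 2)/(p + 1) ≤ 3/2` when the propagation time `p` is
positive. For `p = 0`, all `n + 1` vertices of the subdivision are filled initially, and `n ≥ 2`. -/
lemma two_mul_thTimes_subdivideEdge_le (he : e ∈ G.edgeSet) :
    2 * thTimes .psdForcing (subdivideEdge G e) ≤ 3 * thTimes .psdForcing G := by
  by_cases htop : thTimes .psdForcing G = ⊤
  · rw [htop]
    exact le_top
  obtain ⟨B, t, h1, h3, h4⟩ := thTimes_attained htop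
  match t with
  | 0 =>
    have hB : B = Set.univ := h3
    subst hB
    have : Nontrivial V := by
      induction e with | h u v => exact ⟨u, v, G.ne_of_adj he⟩
    have hcard : 1 < Nat.card V := Finite.one_lt_card
    have h5 := thTimes_le (Y := .psdForcing) (G := subdivideEdge G e)
      (Set.univ_nonempty (α := Option V)) (t := 0) rfl
    rw [h4]
    refine (mul_le_mul_right h5 _).trans ?_
    rw [Set.ncard_univ, Set.ncard_univ, Finite.card_option]
    norm_cast
    omega
  | t + 1 =>
    have h5 := thTimes_le (h1.image some) (filledAfter_subdivideEdge_psdForcing he h3)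
    rw [Set.ncard_image_of_injective _ (Option.some_injective V)] at h5
    rw [h4]
    refine (mul_le_mul_right h5 _).trans ?_
    norm_cast
    rw [mul_left_comm, mul_left_comm 3]
    exact Nat.mul_le_mul_left _ (by omega)

end Inequalities

/-! ### Tools for lower bounds -/

section LowerBounds

variable {V : Type*}

/-- No set of at most `k` vertices fills the graph within `t` time steps. -/
def NotFillable (Y : Param) (G : SimpleGraph V) (k t : ℕ) : Prop :=
  ∀ B : Set V, B.Nonempty → B.ncard ≤ k → filledAfter Y G B t ≠ Set.univ

lemma NotFillable.mono {Y : Param} {G : SimpleGraph V} {k t k' t' : ℕ}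
    (h : NotFillable Y G k' t') (hk : k ≤ k') (ht : t ≤ t') : NotFillable Y G k t :=
  fun B hne hB hu => h B hne (hB.trans hk)
    (Set.univ_subset_iff.1 (hu ▸ filledAfter_mono Y G B ht))

/-- By monotonicity only the corners of the staircase `k * t < c` need to be excluded; `L` lists
them. -/
lemma le_thStar_of_notFillable [Finite V] {Y : Param} {G : SimpleGraph V} {c : ℕ}
    (L : List (ℕ × ℕ)) (hL : ∀ p ∈ L, NotFillable Y G p.1 p.2)
    (hc : ∀ k < c, ∀ t < c, 1 ≤ k ∧ 1 ≤ t ∧ k * t < c → ∃ p ∈ L, k ≤ p.1 ∧ t ≤ p.2) :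
    (c : ℕ∞) ≤ thStar Y G := by
  refine le_thStar fun B t hne ht hB => ?_
  have hk : 1 ≤ B.ncard := (Set.ncard_pos).2 hne
  norm_cast
  by_contra! hlt
  obtain ⟨p, hp, h1, h2⟩ := hc B.ncard (by nlinarith) t (by nlinarith) ⟨hk, ht, hlt⟩
  exact (hL p hp).mono h1 h2 B hne le_rfl hB

lemma le_thTimes_of_notFillable [Finite V] {Y : Param} {G : SimpleGraph V} {c : ℕ}
    (hV : c ≤ Nat.card V)
    (L : List (ℕ × ℕ)) (hL : ∀ p ∈ L, NotFillable Y G p.1 p.2)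
    (hc : ∀ k < c, ∀ t < c, 1 ≤ k ∧ 1 ≤ t ∧ k * (1 + t) < c → ∃ p ∈ L, k ≤ p.1 ∧ t ≤ p.2) :
    (c : ℕ∞) ≤ thTimes Y G := by
  refine le_thTimes fun B t hne hB => ?_
  have hk : 1 ≤ B.ncard := (Set.ncard_pos).2 hne
  norm_cast
  by_contra! hlt
  rcases Nat.eq_zero_or_pos t with rfl | ht
  · have : B = Set.univ := hB
    rw [this, Set.ncard_univ] at hlt
    omega
  obtain ⟨p, hp, h1, h2⟩ := hc B.ncard (by nlinarith) t (by nlinarith) ⟨hk, ht, hlt⟩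
  exact (hL p hp).mono h1 h2 B hne le_rfl hB

lemma exists_eq_singleton [Finite V] {B : Set V} (hne : B.Nonempty) (h : B.ncard ≤ 1) :
    ∃ b, B = {b} :=
  Set.ncard_eq_one.1 (le_antisymm h ((Set.ncard_pos).2 hne))

/-- A set that fills the graph in one step is dominating. -/
lemma notFillable_one_one [Finite V] (Y : Param) {G : SimpleGraph V}
    (h : ∀ v, ∃ w, w ≠ v ∧ ¬ G.Adj v w) : NotFillable Y G 1 1 := by
  intro B hne hB hu
  obtain ⟨v, rfl⟩ := exists_eq_singleton hne hB
  obtain ⟨w, hwv, hw⟩ := h v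
  have hm : w ∈ filledAfter Y G {v} 1 := hu ▸ Set.mem_univ w
  rcases mem_step.1 hm with hm | ⟨x, hx, hxw, -⟩
  · exact hwv hm
  · rw [show x = v from hx] at hxw
    exact hw hxw

/-- A set of vertices without edges to its complement cannot be filled from outside. -/
lemma notFillable_one_of_closed [Finite V] (Y : Param) {G : SimpleGraph V} (F : Set V)
    (hF : F.Nonempty) (hF' : Fᶜ.Nonempty) (h : ∀ a ∈ F, ∀ b ∉ F, ¬ G.Adj a b) (t : ℕ) :
    NotFillable Y G 1 t := by
  have key : ∀ F : Set V, F.Nonempty → (∀ a ∈ F, ∀ b ∉ F, ¬ G.Adj a b) → ∀ v ∉ F,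
      filledAfter Y G {v} t ≠ Set.univ := by
    intro F hF h v hv hu
    have hdisj : ∀ t, ∀ a ∈ F, a ∉ filledAfter Y G {v} t := by
      intro t
      induction t with
      | zero =>
        rintro a ha rfl
        exact hv ha
      | succ t ih =>
        intro a ha hm
        rcases mem_step.1 hm with hm | ⟨x, hx, hxa, -⟩
        · exact ih a ha hm
        · by_cases hxF : x ∈ F
          · exact ih x hxF hx
          · exact h a ha x hxF hxa.symm
    obtain ⟨a, ha⟩ := hF
    exact hdisj t a ha (hu ▸ Set.mem_univ a)
  intro B hne hB
  obtain ⟨v, rfl⟩ := exists_eq_singleton hne hB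
  by_cases hv : v ∈ F
  · exact key Fᶜ hF' (fun a ha b hb hab => h b (not_not.1 hb) a ha hab.symm) v (not_not.2 hv)
  · exact key F hF h v hv

/-- A set of vertices that induces a graph with a dominating vertex cannot be filled from outside
by positive semidefinite forcing if no outer vertex has exactly one neighbor in it. -/
lemma notFillable_psdForcing_one [Finite V] {G : SimpleGraph V}
    (F : V → V → Prop)
    (h : ∀ v, ¬ F v v ∧ (∃ c, F v c ∧ ∀ a, F v a ∧ a ≠ c → G.Adj c a) ∧
      ∀ x a, ¬ F v x ∧ F v a ∧ G.Adj x a → ∃ b, F v b ∧ b ≠ a ∧ G.Adj x b) (t : ℕ) :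
    NotFillable .psdForcing G 1 t := by
  intro B hne hB hu
  obtain ⟨v, rfl⟩ := exists_eq_singleton hne hB
  obtain ⟨hv, ⟨c, hc, hcF⟩, hF⟩ := h v
  have hdisj : ∀ t, ∀ a, F v a → a ∉ filledAfter .psdForcing G {v} t := by
    intro t
    induction t with
    | zero =>
      rintro a ha rfl
      exact hv ha
    | succ t ih =>
      intro a ha hm
      obtain ⟨x, hx, hxa, hx'⟩ := (mem_step.1 hm).resolve_left (ih a ha)
      obtain ⟨b, hb, hba, hxb⟩ := hF x a ⟨fun hxF => ih x hxF hx, ha, hxa⟩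
      refine hba (hx' b (ih b hb) ?_ hxb)
      have hac : Relation.ReflTransGen
          (fun a b => G.Adj a b ∧ b ∉ filledAfter .psdForcing G {v} t) a c := by
        by_cases hac : a = c
        · rw [hac]
        · exact .single ⟨(hcF a ⟨ha, hac⟩).symm, ih c hc⟩
      by_cases hbc : b = c
      · exact hbc ▸ hac
      · exact hac.tail ⟨hcF b ⟨hb, hbc⟩, ih b hb⟩
  exact hdisj t c hc (hu ▸ Set.mem_univ c)

end LowerBounds

/-! ### Stars and schedules for upper bounds -/

section UpperBounds

variable {V : Type*}

lemma filledAfter_one_of_star (Y : Param) {G : SimpleGraph V} (c : V)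
    (hc : ∀ a b, G.Adj a b → a = c ∨ b = c) (h : ∀ a, a ≠ c → G.Adj c a) :
    filledAfter Y G {c} 1 = Set.univ := by
  refine Set.eq_univ_of_forall fun w => mem_step.2 ?_
  by_cases hw : w = c
  · exact Or.inl hw
  refine Or.inr ⟨c, rfl, h w hw, fun x hx hb _ => ?_⟩
  match Y with
  | .powerDomination => exact hb.elim
  | .psdForcing =>
    rcases Relation.ReflTransGen.cases_head hb with h0 | ⟨d, ⟨hd, hdc⟩, -⟩
    · exact h0.symm
    · rcases hc _ _ hd with rfl | rfl
      · exact absurd rfl hw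
      · exact absurd rfl hdc

lemma thStar_star_le [Finite V] (Y : Param) {G : SimpleGraph V} (hG : HasEdge G) (c : V)
    (hc : ∀ a b, G.Adj a b → a = c ∨ b = c) (h : ∀ a, a ≠ c → G.Adj c a) :
    thStar Y G ≤ 1 := by
  simpa using thStar_le hG (Set.singleton_nonempty c) le_rfl (filledAfter_one_of_star Y c hc h)

lemma thTimes_star_le [Finite V] (Y : Param) {G : SimpleGraph V} (c : V)
    (hc : ∀ a b, G.Adj a b → a = c ∨ b = c) (h : ∀ a, a ≠ c → G.Adj c a) :
    thTimes Y G ≤ 2 := by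
  have := thTimes_le (Set.singleton_nonempty c) (filledAfter_one_of_star Y c hc h)
  rw [Set.ncard_singleton] at this
  exact this.trans (by norm_num)

/-- A schedule `τ` with forcing vertices `p` bounds the power domination propagation time. -/
lemma filledAfter_of_schedule {G : SimpleGraph V} {c : V} (τ : V → ℕ) (p : V → V) {t : ℕ}
    (h : ∀ w, w = c ∨ (0 < τ w ∧ τ w ≤ t ∧ τ (p w) < τ w ∧ G.Adj (p w) w ∧
      (τ w = 1 ∨ ∀ y, G.Adj (p w) y → y = w ∨ τ y < τ w)))
    (hc : ∀ w, τ w = 0 → w = c) :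
    filledAfter .powerDomination G {c} t = Set.univ := by
  have key : ∀ s, ∀ w, τ w ≤ s → w ∈ filledAfter .powerDomination G {c} s := by
    intro s
    induction s with
    | zero => exact fun w hw => hc w (Nat.le_zero.1 hw)
    | succ s ih =>
      intro w hw
      refine mem_step.2 ?_
      by_cases hws : τ w ≤ s
      · exact Or.inl (ih w hws)
      have hτ : τ w = s + 1 := by omega
      rcases h w with hwc | ⟨-, -, h1, h2, h3⟩
      · exact Or.inl (filledAfter_mono _ _ _ (Nat.zero_le s) hwc)
      refine Or.inr ⟨p w, ih _ (by omega), h2, fun y hy hb hpy => ?_⟩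
      match s with
      | 0 => exact hb.elim
      | s + 1 =>
        refine ((h3.resolve_left (by omega)) y hpy).resolve_right fun hlt => hy (ih y (by omega))
  refine Set.eq_univ_of_forall fun w => ?_
  rcases h w with hwc | ⟨-, h1, -⟩
  · exact filledAfter_mono _ _ _ (Nat.zero_le t) hwc
  · exact key t w h1

end UpperBounds

/-! ### Exhaustive search for power domination -/

section Masks

/-- The effect of one time step of power domination on sets of vertices `< n` that are encoded as
bit masks; `nb` lists the neighborhoods, and only the vertices `< i` fill other vertices. -/
def maskStep (nb : List ℕ) (first : Bool) (m : ℕ) : ℕ → ℕ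
  | 0 => m
  | i + 1 =>
    -- The number `(nb ||| m) ^^^ m` encodes the unfilled neighbors of `i`; it equals `2 ^ log2` of
    -- itself exactly when there is one such neighbor, and the empty set fails since `0 ≠ 2 ^ 0`.
    bif m.testBit i &&
        (first || Nat.beq ((nb.getD i 0 ||| m) ^^^ m) (2 ^ ((nb.getD i 0 ||| m) ^^^ m).log2)) then
      maskStep nb first m i ||| nb.getD i 0
    else maskStep nb first m i

/-- The bit mask of the vertices filled after `t` time steps. -/
def maskFill (nb : List ℕ) (n m : ℕ) : ℕ → ℕ
  | 0 => m
  | t + 1 => maskStep nb (Nat.beq t 0) (maskFill nb n m t) n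

/-- Whether `P` holds for all masks obtained from `m` by adding at most `k` elements `< n`, up to
supersets. -/
def forallMasks (P : ℕ → Bool) : ℕ → ℕ → ℕ → Bool
  | 0, _, m => P m
  | _ + 1, 0, m => P m
  | n + 1, k + 1, m => forallMasks P n (k + 1) m && forallMasks P n k (m ||| 2 ^ n)

lemma forallMasks_spec {P : ℕ → Bool} {n k m : ℕ} (h : forallMasks P n k m = true)
    (s : Finset ℕ) (hs : s ⊆ Finset.range n) (hk : s.card ≤ k) :
    ∃ m', P m' = true ∧ (∀ i, m.testBit i → m'.testBit i) ∧ ∀ i ∈ s, m'.testBit i := by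
  induction n, k, m using forallMasks.induct generalizing s with
  | case1 k m =>
    have : s = ∅ := Finset.subset_empty.1 hs
    exact ⟨m, by simpa [forallMasks] using h, fun i hi => hi, by simp [this]⟩
  | case2 n m =>
    have : s = ∅ := Finset.card_eq_zero.1 (Nat.le_zero.1 hk)
    exact ⟨m, by simpa [forallMasks] using h, fun i hi => hi, by simp [this]⟩
  | case3 n k m ih1 ih2 =>
    simp only [forallMasks, Bool.and_eq_true] at h
    by_cases hn : n ∈ s
    · obtain ⟨m', h1, h2, h3⟩ := ih2 h.2 (s.erase n) (by
        intro i hi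
        have h1 := hs (Finset.mem_of_mem_erase hi)
        have h2 := Finset.ne_of_mem_erase hi
        simp only [Finset.mem_range] at h1 ⊢
        omega) (by rw [Finset.card_erase_of_mem hn]; omega)
      refine ⟨m', h1, fun i hi => h2 i (by simp [hi]), fun i hi => ?_⟩
      by_cases hin : i = n
      · exact h2 i (by simp [hin])
      · exact h3 i (Finset.mem_erase.2 ⟨hin, hi⟩)
    · refine ih1 h.1 s (fun i hi => ?_) hk
      have h1 := hs hi
      have h2 : i ≠ n := fun h => hn (h ▸ hi)
      simp only [Finset.mem_range] at h1 ⊢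
      omega

/-- Every force is tested against the original `m`, not the accumulated mask, so the recursion
performs one simultaneous step. -/
lemma testBit_maskStep {nb : List ℕ} {first : Bool} {m n j : ℕ} :
    (maskStep nb first m n).testBit j ↔ m.testBit j ∨ ∃ i < n, m.testBit i ∧
      (first ∨ (nb.getD i 0 ||| m) ^^^ m = 2 ^ ((nb.getD i 0 ||| m) ^^^ m).log2) ∧
      (nb.getD i 0).testBit j := by
  induction n with
  | zero => simp [maskStep]
  | succ n ih =>
    simp only [maskStep]
    have hex : ∀ p : ℕ → Prop, (∃ i < n + 1, p i) ↔ (∃ i < n, p i) ∨ p n := fun p => by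
      simp only [Nat.lt_succ_iff_lt_or_eq, or_and_right, exists_or, exists_eq_left]
    rw [hex]
    cases hc : (m.testBit n && (first ||
      Nat.beq ((nb.getD n 0 ||| m) ^^^ m) (2 ^ ((nb.getD n 0 ||| m) ^^^ m).log2)))
    · rw [Bool.eq_false_iff, ne_eq, Bool.and_eq_true, Bool.or_eq_true, Nat.beq_eq] at hc
      simp only [cond_false, ih]
      constructor
      · exact fun h => h.imp_right Or.inl
      · rintro (h | h | ⟨h1, h2, -⟩)
        · exact Or.inl h
        · exact Or.inr h
        · exact absurd ⟨h1, h2⟩ hc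
    · rw [Bool.and_eq_true, Bool.or_eq_true, Nat.beq_eq] at hc
      simp only [cond_true, Nat.testBit_or, Bool.or_eq_true, ih]
      constructor
      · rintro ((h | h) | h)
        · exact Or.inl h
        · exact Or.inr (Or.inl h)
        · exact Or.inr (Or.inr ⟨hc.1, hc.2, h⟩)
      · rintro (h | h | ⟨-, -, h⟩)
        · exact Or.inl (Or.inl h)
        · exact Or.inl (Or.inr h)
        · exact Or.inr h

variable {V : Type*} {G : SimpleGraph V} {n : ℕ} {nb : List ℕ} {g : V → ℕ}

lemma testBit_maskFill (hlt : ∀ a, g a < n)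
    (hsurj : ∀ i < n, ∃ a, g a = i) (hnb : ∀ i < n, nb.getD i 0 < 2 ^ n)
    (hadj : ∀ a b, G.Adj a b ↔ (nb.getD (g a) 0).testBit (g b)) {B : Set V} {m : ℕ}
    (hB : ∀ a ∈ B, m.testBit (g a)) (t : ℕ) :
    ∀ a ∈ filledAfter .powerDomination G B t, (maskFill nb n m t).testBit (g a) := by
  induction t with
  | zero => exact hB
  | succ t ih =>
    intro w hw
    rw [filledAfter_succ, mem_step] at hw
    simp only [maskFill]
    generalize filledAfter .powerDomination G B t = S at *
    generalize maskFill nb n m t = M at *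
    rw [testBit_maskStep]
    by_cases hwM : M.testBit (g w)
    · exact Or.inl hwM
    obtain ⟨v, hv, hvw, h⟩ := hw.resolve_left fun h => hwM (ih w h)
    refine Or.inr ⟨g v, hlt v, ih v hv, ?_, (hadj v w).1 hvw⟩
    match t with
    | 0 => exact Or.inl rfl
    | t + 1 =>
      refine Or.inr ?_
      -- A second neighbor of `v` outside `M` would also lie outside `S`, which is encoded within
      -- `M`, and would block the force.
      have hpow : (nb.getD (g v) 0 ||| M) ^^^ M = 2 ^ g w := by
        refine Nat.eq_of_testBit_eq fun j => ?_
        rw [Nat.testBit_two_pow, Nat.testBit_xor, Nat.testBit_or]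
        by_cases hj : j = g w
        · subst hj
          rw [(hadj v w).1 hvw, Bool.eq_false_iff.2 hwM]
          simp
        · have hj' : ¬ g w = j := fun h => hj h.symm
          cases hMj : M.testBit j
          · cases hvj : (nb.getD (g v) 0).testBit j
            · simp [hj']
            · exfalso
              have hjn : j < n := by
                by_contra! hjn
                rw [Nat.testBit_lt_two_pow ((hnb _ (hlt v)).trans_le
                  (Nat.pow_le_pow_right (by norm_num) hjn))] at hvj
                exact Bool.false_ne_true hvj
              obtain ⟨y, rfl⟩ := hsurj j hjn
              have hyS : y ∉ S := fun hy => by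
                rw [ih y hy] at hMj
                exact Bool.false_ne_true hMj.symm
              exact hj (by rw [h y hyS trivial ((hadj v y).2 hvj)])
          · simp [hj']
      rw [hpow, Nat.log2_two_pow]

lemma notFillable_of_forallMasks [Finite V] (hlt : ∀ a, g a < n)
    (hsurj : ∀ i < n, ∃ a, g a = i) (hnb : ∀ i < n, nb.getD i 0 < 2 ^ n)
    (hadj : ∀ a b, G.Adj a b ↔ (nb.getD (g a) 0).testBit (g b)) {k t : ℕ}
    (h : forallMasks (fun m => !Nat.beq (maskFill nb n m t &&& (2 ^ n - 1)) (2 ^ n - 1)) n k 0) :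
    NotFillable .powerDomination G k t := by
  classical
  intro B _ hB hu
  obtain ⟨m, hm, -, hmB⟩ := forallMasks_spec h (B.toFinite.toFinset.image g) (by
    intro i hi
    obtain ⟨a, -, rfl⟩ := Finset.mem_image.1 hi
    exact Finset.mem_range.2 (hlt a)) (by
    refine Finset.card_image_le.trans ?_
    rwa [← Set.ncard_eq_toFinset_card B])
  rw [Bool.not_eq_true', Bool.eq_false_iff, ne_eq, Nat.beq_eq] at hm
  refine hm (Nat.eq_of_testBit_eq fun j => ?_)
  rw [Nat.testBit_and, Nat.testBit_two_pow_sub_one]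
  by_cases hj : j < n
  · obtain ⟨a, rfl⟩ := hsurj j hj
    have := testBit_maskFill hlt hsurj hnb hadj (B := B) (m := m)
      (fun a ha => hmB _ (Finset.mem_image_of_mem g (by simpa using ha))) t a (hu ▸ Set.mem_univ a)
    simp [this]
  · simp [hj]

end Masks

/-! ### Examples of equality -/

section Examples

/-- The graph on `Fin n` with the given list of edges. -/
def edgeListGraph (n : ℕ) (l : List (ℕ × ℕ)) : SimpleGraph (Fin n) where
  Adj i j := i ≠ j ∧ ((i.val, j.val) ∈ l ∨ (j.val, i.val) ∈ l)
  symm := ⟨fun _ _ h => ⟨h.1.symm, h.2.symm⟩⟩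
  loopless := ⟨fun _ h => h.1 rfl⟩

instance (n : ℕ) (l : List (ℕ × ℕ)) : DecidableRel (edgeListGraph n l).Adj :=
  fun i j => inferInstanceAs (Decidable (i ≠ j ∧ ((i.val, j.val) ∈ l ∨ (j.val, i.val) ∈ l)))

lemma eq_two_mul_of_le {a b : ℕ∞} {s : ℕ} (h : a ≤ 2 * b) (hb : b ≤ s) (ha : (2 * s : ℕ) ≤ a) :
    a = 2 * b := by
  refine le_antisymm h ((mul_le_mul_right hb 2).trans ?_)
  exact_mod_cast ha

variable {V : Type*} {G : SimpleGraph V} {e : Sym2 V}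

lemma hasEdge_of_adj {u v : V} (h : G.Adj u v) : HasEdge G := ⟨s(u, v), h⟩

lemma contractEdge_mk_adj_iff {a b : V} :
    (contractEdge G e).Adj (Quotient.mk _ a) (Quotient.mk _ b) ↔
      ¬ (a = b ∨ (a ∈ e ∧ b ∈ e)) ∧ ∃ a' b', G.Adj a' b' ∧ (a' = a ∨ (a' ∈ e ∧ a ∈ e)) ∧
        (b' = b ∨ (b' ∈ e ∧ b ∈ e)) := by
  simp only [contractEdge_adj_iff, ne_eq, contractEdge_mk_eq_iff]

/-- The hypotheses speak of representatives only, so that they can be decided on a concrete graph.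
-/
lemma contractEdge_star (c : V)
    (h1 : ∀ a b, G.Adj a b → (a ∈ e ∧ b ∈ e) ∨ (a = c ∨ (a ∈ e ∧ c ∈ e)) ∨
      (b = c ∨ (b ∈ e ∧ c ∈ e)))
    (h2 : ∀ a, (a = c ∨ (a ∈ e ∧ c ∈ e)) ∨ ∃ a' b', G.Adj a' b' ∧ (a' = c ∨ (a' ∈ e ∧ c ∈ e)) ∧
        (b' = a ∨ (b' ∈ e ∧ a ∈ e))) :
    (∀ p q, (contractEdge G e).Adj p q → p = Quotient.mk _ c ∨ q = Quotient.mk _ c) ∧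
      ∀ p, p ≠ Quotient.mk _ c → (contractEdge G e).Adj (Quotient.mk _ c) p := by
  constructor
  · intro p q hpq
    obtain ⟨hne, a, b, hab, rfl, rfl⟩ := contractEdge_adj_iff.1 hpq
    rw [ne_eq] at hne
    rw [contractEdge_mk_eq_iff] at hne ⊢
    rw [contractEdge_mk_eq_iff]
    rcases h1 a b hab with h | h
    · exact absurd (Or.inr h) hne
    · exact h
  · intro p hp
    induction p using Quotient.inductionOn with | h a => ?_
    refine contractEdge_mk_adj_iff.2 ⟨fun h => hp ?_, ?_⟩
    · exact contractEdge_mk_eq_iff.2 (h.imp Eq.symm And.symm)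
    · exact (h2 a).resolve_left fun h => hp (contractEdge_mk_eq_iff.2 h)

lemma notFillable_contractEdge [Finite V] {n : ℕ} {nb : List ℕ} (f : V → ℕ)
    (hf : ∀ a b, (a = b ∨ (a ∈ e ∧ b ∈ e)) → f a = f b) (hlt : ∀ a, f a < n)
    (hsurj : ∀ i < n, ∃ a, f a = i) (hnb : ∀ i < n, nb.getD i 0 < 2 ^ n)
    (hadj : ∀ a b, (¬ (a = b ∨ (a ∈ e ∧ b ∈ e)) ∧ ∃ a' b', G.Adj a' b' ∧
        (a' = a ∨ (a' ∈ e ∧ a ∈ e)) ∧ (b' = b ∨ (b' ∈ e ∧ b ∈ e))) ↔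
      (nb.getD (f a) 0).testBit (f b)) {k t : ℕ}
    (h : forallMasks (fun m => !Nat.beq (maskFill nb n m t &&& (2 ^ n - 1)) (2 ^ n - 1)) n k 0) :
    NotFillable .powerDomination (contractEdge G e) k t := by
  refine notFillable_of_forallMasks (n := n) (nb := nb)
    (g := Quotient.lift f fun a b hab => hf a b hab) ?_ ?_ hnb ?_ h
  · intro p
    induction p using Quotient.inductionOn with | h a => exact hlt a
  · intro i hi
    obtain ⟨a, ha⟩ := hsurj i hi
    exact ⟨Quotient.mk _ a, ha⟩
  · intro p q
    induction p using Quotient.inductionOn with | h a => ?_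
    induction q using Quotient.inductionOn with | h b => ?_
    rw [contractEdge_mk_adj_iff]
    exact hadj a b

lemma notFillable_fin {n : ℕ} {G : SimpleGraph (Fin n)} (nb : List ℕ)
    (hnb : ∀ i < n, nb.getD i 0 < 2 ^ n)
    (hadj : ∀ a b, G.Adj a b ↔ (nb.getD a.val 0).testBit b.val) {k t : ℕ}
    (h : forallMasks (fun m => !Nat.beq (maskFill nb n m t &&& (2 ^ n - 1)) (2 ^ n - 1)) n k 0) :
    NotFillable .powerDomination G k t :=
  notFillable_of_forallMasks (g := Fin.val) (fun a => a.2) (fun i hi => ⟨⟨i, hi⟩, rfl⟩) hnb hadj h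

lemma thStar_singleton_le [Finite V] (hG : HasEdge G) {c : V} {t : ℕ} (ht : 1 ≤ t)
    (h : filledAfter .powerDomination G {c} t = Set.univ) :
    thStar .powerDomination G ≤ t := by
  simpa using thStar_le hG (Set.singleton_nonempty c) ht h

lemma thTimes_singleton_le [Finite V] {c : V} {t : ℕ}
    (h : filledAfter .powerDomination G {c} t = Set.univ) :
    thTimes .powerDomination G ≤ (1 + t : ℕ) := by
  simpa using thTimes_le (Set.singleton_nonempty c) h

/-! ### Edge deletion -/

lemma thStar_eq_two_mul_deleteEdge (Y : Param) :
    ∃ (n : ℕ) (G : SimpleGraph (Fin n)) (e : Sym2 (Fin n)),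
      e ∈ G.edgeSet ∧ HasEdge (deleteEdge G e) ∧ thStar Y G = 2 * thStar Y (deleteEdge G e) := by
  match Y with
  | .powerDomination =>
    -- Deleting `13` turns the triangle `123` into a leg, and the hub `0` fills the resulting spider
    -- in three steps; with the triangle, `1` faces two unfilled neighbors. The closed neighborhoods
    -- of `2, 6, 8, 10, 12, 13` are disjoint, so five vertices do not dominate.
    let G := edgeListGraph 14 [(0, 1), (1, 2), (2, 3), (1, 3), (0, 4), (4, 5), (5, 6), (0, 7),
      (7, 8), (0, 9), (9, 10), (0, 11), (11, 12), (0, 13)]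
    have he : s(1, 3) ∈ G.edgeSet := show G.Adj 1 3 by decide
    have hd : HasEdge (deleteEdge G s(1, 3)) :=
      hasEdge_of_adj ((deleteEdge_adj_iff _ _ 0 1).2 (by decide))
    refine ⟨14, G, s(1, 3), he, hd, eq_two_mul_of_le (s := 3)
      (thStar_le_two_mul_deleteEdge _ he hd) (thStar_singleton_le (c := 0) hd (by norm_num) ?_) ?_⟩
    · refine filledAfter_of_schedule ![0, 1, 2, 3, 1, 2, 3, 1, 2, 1, 2, 1, 2, 1]
        ![0, 0, 1, 2, 0, 4, 5, 0, 7, 0, 9, 0, 11, 0] ?_ (by decide)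
      simp only [deleteEdge_adj_iff]
      decide +kernel
    · refine le_thStar_of_notFillable [(5, 1), (2, 2), (1, 5)] ?_ (by decide)
      have h := @notFillable_fin _ G [10898, 13, 10, 6, 33, 80, 32, 257, 128, 1025, 512, 4097,
        2048, 1] (by decide +kernel) (by decide +kernel)
      simp only [List.forall_mem_cons, List.not_mem_nil, false_imp_iff, implies_true, and_true]
      exact ⟨h (by decide +kernel), h (by decide +kernel), h (by decide +kernel)⟩
  | .psdForcing =>
    let G := edgeListGraph 3 [(0, 1), (0, 2), (1, 2)]
    have he : s(1, 2) ∈ G.edgeSet := show G.Adj 1 2 by decide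
    have hd : HasEdge (deleteEdge G s(1, 2)) :=
      hasEdge_of_adj ((deleteEdge_adj_iff _ _ 0 1).2 (by decide))
    refine ⟨3, G, s(1, 2), he, hd, eq_two_mul_of_le (s := 1)
      (thStar_le_two_mul_deleteEdge _ he hd) (thStar_star_le _ hd 0 ?_ ?_) ?_⟩
    · simp only [deleteEdge_adj_iff]
      decide
    · simp only [deleteEdge_adj_iff]
      decide
    · refine le_thStar_of_notFillable [(1, 1)] (List.forall_mem_singleton.2 ?_) (by decide)
      exact notFillable_psdForcing_one (fun v x => x ≠ v) (by decide) 1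

lemma thStar_deleteEdge_eq_two_mul (Y : Param) :
    ∃ (n : ℕ) (G : SimpleGraph (Fin n)) (e : Sym2 (Fin n)),
      e ∈ G.edgeSet ∧ HasEdge (deleteEdge G e) ∧ thStar Y (deleteEdge G e) = 2 * thStar Y G := by
  let G := edgeListGraph 3 [(0, 1), (0, 2)]
  have he : s(0, 2) ∈ G.edgeSet := show G.Adj 0 2 by decide
  have hd : HasEdge (deleteEdge G s(0, 2)) :=
    hasEdge_of_adj ((deleteEdge_adj_iff _ _ 0 1).2 (by decide))
  refine ⟨3, G, s(0, 2), he, hd, eq_two_mul_of_le (s := 1)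
    (thStar_deleteEdge_le_two_mul _ he hd)
    (thStar_star_le _ ⟨_, he⟩ 0 (by decide) (by decide)) ?_⟩
  refine le_thStar_of_notFillable [(1, 1)] (List.forall_mem_singleton.2 ?_) (by decide)
  refine notFillable_one_one Y ?_
  simp only [deleteEdge_adj_iff]
  decide

lemma thTimes_eq_two_mul_deleteEdge (Y : Param) :
    ∃ (n : ℕ) (G : SimpleGraph (Fin n)) (e : Sym2 (Fin n)),
      e ∈ G.edgeSet ∧ HasEdge (deleteEdge G e) ∧
        thTimes Y G = 2 * thTimes Y (deleteEdge G e) := by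
  match Y with
  | .powerDomination =>
    let G := edgeListGraph 10 [(0, 1), (1, 2), (2, 3), (1, 3), (0, 4), (4, 5), (5, 6), (0, 7),
      (7, 8), (0, 9)]
    have he : s(1, 3) ∈ G.edgeSet := show G.Adj 1 3 by decide
    have hd : HasEdge (deleteEdge G s(1, 3)) :=
      hasEdge_of_adj ((deleteEdge_adj_iff _ _ 0 1).2 (by decide))
    refine ⟨10, G, s(1, 3), he, hd, eq_two_mul_of_le (s := 1 + 3)
      (thTimes_le_two_mul_deleteEdge _ _ _) (thTimes_singleton_le (c := 0) ?_) ?_⟩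
    · refine filledAfter_of_schedule ![0, 1, 2, 3, 1, 2, 3, 1, 2, 1]
        ![0, 0, 1, 2, 0, 4, 5, 0, 7, 0] ?_ (by decide)
      simp only [deleteEdge_adj_iff]
      decide +kernel
    · refine le_thTimes_of_notFillable (by simp) [(3, 1), (2, 2), (1, 6)] ?_ (by decide)
      have h := @notFillable_fin _ G [658, 13, 10, 6, 33, 80, 32, 257, 128, 1]
        (by decide +kernel) (by decide +kernel)
      simp only [List.forall_mem_cons, List.not_mem_nil, false_imp_iff, implies_true, and_true]
      exact ⟨h (by decide +kernel), h (by decide +kernel), h (by decide +kernel)⟩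
  | .psdForcing =>
    let G := edgeListGraph 4 [(0, 1), (0, 2), (0, 3), (1, 2)]
    have he : s(1, 2) ∈ G.edgeSet := show G.Adj 1 2 by decide
    have hd : HasEdge (deleteEdge G s(1, 2)) :=
      hasEdge_of_adj ((deleteEdge_adj_iff _ _ 0 1).2 (by decide))
    refine ⟨4, G, s(1, 2), he, hd, eq_two_mul_of_le (s := 2)
      (thTimes_le_two_mul_deleteEdge _ _ _) (thTimes_star_le _ 0 ?_ ?_) ?_⟩
    · simp only [deleteEdge_adj_iff]
      decide
    · simp only [deleteEdge_adj_iff]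
      decide
    · refine le_thTimes_of_notFillable (by simp) [(1, 2)] (List.forall_mem_singleton.2 ?_)
        (by decide)
      exact notFillable_psdForcing_one
        -- For each start `v`, a set that stays unfilled: the edge `12` for `v = 0, 3`, all other
        -- vertices for `v = 1, 2`.
        (fun v x => x ∈ (![[1, 2], [0, 2, 3], [0, 1, 3], [1, 2]] : Fin 4 → List (Fin 4)) v)
        (by decide) 2

lemma thTimes_deleteEdge_eq_two_mul (Y : Param) :
    ∃ (n : ℕ) (G : SimpleGraph (Fin n)) (e : Sym2 (Fin n)),
      e ∈ G.edgeSet ∧ HasEdge (deleteEdge G e) ∧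
        thTimes Y (deleteEdge G e) = 2 * thTimes Y G := by
  let G := edgeListGraph 4 [(0, 1), (0, 2), (0, 3)]
  have he : s(0, 3) ∈ G.edgeSet := show G.Adj 0 3 by decide
  have hd : HasEdge (deleteEdge G s(0, 3)) :=
    hasEdge_of_adj ((deleteEdge_adj_iff _ _ 0 1).2 (by decide))
  refine ⟨4, G, s(0, 3), he, hd, eq_two_mul_of_le (s := 2)
    (thTimes_deleteEdge_le_two_mul _ _ _) (thTimes_star_le _ 0 (by decide) (by decide)) ?_⟩
  refine le_thTimes_of_notFillable (by simp) [(1, 2)] (List.forall_mem_singleton.2 ?_) (by decide)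
  refine notFillable_one_of_closed Y {3} ⟨3, rfl⟩ ⟨0, by simp⟩ ?_ 2
  simp only [deleteEdge_adj_iff, Set.mem_singleton_iff]
  decide

/-! ### Vertex deletion -/

lemma thStar_eq_two_mul_deleteVertex (Y : Param) :
    ∃ (n : ℕ) (G : SimpleGraph (Fin n)) (x : Fin n),
      HasEdge (deleteVertex G x) ∧ thStar Y G = 2 * thStar Y (deleteVertex G x) := by
  let G := edgeListGraph 3 [(0, 1)]
  let c : ({2}ᶜ : Set (Fin 3)) := ⟨0, by decide⟩
  have hadj : ∀ a, a ≠ c → (deleteVertex G 2).Adj c a := by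
    rintro ⟨a, ha⟩ hac
    have : ∀ a : Fin 3, a ≠ 2 → a ≠ 0 → G.Adj 0 a := by decide
    exact this a ha fun h => hac (Subtype.ext h)
  have hd : HasEdge (deleteVertex G 2) := hasEdge_of_adj (hadj ⟨1, by decide⟩ (by decide))
  refine ⟨3, G, 2, hd, eq_two_mul_of_le (s := 1) (thStar_le_two_mul_deleteVertex Y hd)
    (thStar_star_le _ hd c ?_ hadj) ?_⟩
  · rintro ⟨a, ha⟩ ⟨b, hb⟩ hab
    have : ∀ a b : Fin 3, G.Adj a b → a = 0 ∨ b = 0 := by decide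
    exact (this a b hab).imp Subtype.ext Subtype.ext
  · refine le_thStar_of_notFillable [(1, 1)] (List.forall_mem_singleton.2 ?_) (by decide)
    exact notFillable_one_one Y (by decide)

lemma thTimes_eq_two_mul_deleteVertex (Y : Param) :
    ∃ (n : ℕ) (G : SimpleGraph (Fin n)) (x : Fin n),
      HasEdge (deleteVertex G x) ∧ thTimes Y G = 2 * thTimes Y (deleteVertex G x) := by
  let G := edgeListGraph 4 [(0, 1), (0, 2)]
  let c : ({3}ᶜ : Set (Fin 4)) := ⟨0, by decide⟩
  have hadj : ∀ a, a ≠ c → (deleteVertex G 3).Adj c a := by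
    rintro ⟨a, ha⟩ hac
    have : ∀ a : Fin 4, a ≠ 3 → a ≠ 0 → G.Adj 0 a := by decide
    exact this a ha fun h => hac (Subtype.ext h)
  have hd : HasEdge (deleteVertex G 3) := hasEdge_of_adj (hadj ⟨1, by decide⟩ (by decide))
  refine ⟨4, G, 3, hd, eq_two_mul_of_le (s := 2) (thTimes_le_two_mul_deleteVertex G Y 3)
    (thTimes_star_le _ c ?_ hadj) ?_⟩
  · rintro ⟨a, ha⟩ ⟨b, hb⟩ hab
    have : ∀ a b : Fin 4, G.Adj a b → a = 0 ∨ b = 0 := by decide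
    exact (this a b hab).imp Subtype.ext Subtype.ext
  · refine le_thTimes_of_notFillable (by simp) [(1, 2)] (List.forall_mem_singleton.2 ?_)
      (by decide)
    refine notFillable_one_of_closed Y {3} ⟨3, rfl⟩ ⟨0, by simp⟩ ?_ 2
    simp only [Set.mem_singleton_iff]
    decide

/-! ### Edge contraction -/

lemma thStar_eq_two_mul_contractEdge (Y : Param) :
    ∃ (n : ℕ) (G : SimpleGraph (Fin n)) (e : Sym2 (Fin n)),
      e ∈ G.edgeSet ∧ HasEdge (contractEdge G e) ∧
        thStar Y G = 2 * thStar Y (contractEdge G e) := by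
  match Y with
  | .powerDomination =>
    let G := edgeListGraph 4 [(0, 1), (1, 2), (2, 3)]
    have he : s(1, 2) ∈ G.edgeSet := show G.Adj 1 2 by decide
    have hd : HasEdge (contractEdge G s(1, 2)) :=
      hasEdge_of_adj ((contractEdge_mk_adj_iff (a := 0) (b := 1)).2 (by decide))
    have hs := contractEdge_star (G := G) (e := s(1, 2)) 1 (by decide) (by decide)
    refine ⟨4, G, s(1, 2), he, hd, eq_two_mul_of_le (s := 1)
      (thStar_le_two_mul_contractEdge _ he hd) (thStar_star_le _ hd _ hs.1 hs.2) ?_⟩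
    refine le_thStar_of_notFillable [(1, 1)] (List.forall_mem_singleton.2 ?_) (by decide)
    exact notFillable_one_one _ (by decide)
  | .psdForcing =>
    let G := edgeListGraph 3 [(0, 1), (0, 2), (1, 2)]
    have he : s(1, 2) ∈ G.edgeSet := show G.Adj 1 2 by decide
    have hd : HasEdge (contractEdge G s(1, 2)) :=
      hasEdge_of_adj ((contractEdge_mk_adj_iff (a := 0) (b := 1)).2 (by decide))
    have hs := contractEdge_star (G := G) (e := s(1, 2)) 0 (by decide) (by decide)
    refine ⟨3, G, s(1, 2), he, hd, eq_two_mul_of_le (s := 1)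
      (thStar_le_two_mul_contractEdge _ he hd) (thStar_star_le _ hd _ hs.1 hs.2) ?_⟩
    refine le_thStar_of_notFillable [(1, 1)] (List.forall_mem_singleton.2 ?_) (by decide)
    exact notFillable_psdForcing_one (fun v x => x ≠ v) (by decide) 1

lemma thTimes_eq_two_mul_contractEdge (Y : Param) :
    ∃ (n : ℕ) (G : SimpleGraph (Fin n)) (e : Sym2 (Fin n)),
      e ∈ G.edgeSet ∧ HasEdge (contractEdge G e) ∧
        thTimes Y G = 2 * thTimes Y (contractEdge G e) := by
  match Y with
  | .powerDomination =>
    let G := edgeListGraph 6 [(0, 4), (1, 4), (2, 5), (3, 5), (4, 5)]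
    have he : s(4, 5) ∈ G.edgeSet := show G.Adj 4 5 by decide
    have hd : HasEdge (contractEdge G s(4, 5)) :=
      hasEdge_of_adj ((contractEdge_mk_adj_iff (a := 0) (b := 4)).2 (by decide))
    have hs := contractEdge_star (G := G) (e := s(4, 5)) 4 (by decide) (by decide)
    refine ⟨6, G, s(4, 5), he, hd, eq_two_mul_of_le (s := 2)
      (thTimes_le_two_mul_contractEdge _ _ _) (thTimes_star_le _ _ hs.1 hs.2) ?_⟩
    refine le_thTimes_of_notFillable (by simp) [(1, 2)] (List.forall_mem_singleton.2 ?_)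
      (by decide)
    exact notFillable_fin [16, 16, 32, 32, 35, 28] (by decide) (by decide) (by decide +kernel)
  | .psdForcing =>
    let G := edgeListGraph 4 [(0, 1), (0, 2), (0, 3), (1, 2)]
    have he : s(1, 2) ∈ G.edgeSet := show G.Adj 1 2 by decide
    have hd : HasEdge (contractEdge G s(1, 2)) :=
      hasEdge_of_adj ((contractEdge_mk_adj_iff (a := 0) (b := 1)).2 (by decide))
    have hs := contractEdge_star (G := G) (e := s(1, 2)) 0 (by decide) (by decide)
    refine ⟨4, G, s(1, 2), he, hd, eq_two_mul_of_le (s := 2)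
      (thTimes_le_two_mul_contractEdge _ _ _) (thTimes_star_le _ _ hs.1 hs.2) ?_⟩
    refine le_thTimes_of_notFillable (by simp) [(1, 2)] (List.forall_mem_singleton.2 ?_)
      (by decide)
    exact notFillable_psdForcing_one
      (fun v x => x ∈ (![[1, 2], [0, 2, 3], [0, 1, 3], [1, 2]] : Fin 4 → List (Fin 4)) v)
      (by decide) 2

/-- In `G`, the vertices `8` and `9` each fill one pendant vertex after the hub `0` has filled them.
Their merger has two pendant vertices, and the process from the hub stalls. -/
lemma thStar_contractEdge_eq_two_mul :
    ∃ (n : ℕ) (G : SimpleGraph (Fin n)) (e : Sym2 (Fin n)),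
      e ∈ G.edgeSet ∧ HasEdge (contractEdge G e) ∧
      thStar .powerDomination (contractEdge G e) = 2 * thStar .powerDomination G := by
  let G := edgeListGraph 10 [(0, 8), (0, 9), (8, 9), (1, 8), (2, 9), (0, 3), (3, 4), (0, 5),
    (5, 6), (0, 7)]
  have he : s(8, 9) ∈ G.edgeSet := show G.Adj 8 9 by decide
  have hd : HasEdge (contractEdge G s(8, 9)) :=
    hasEdge_of_adj ((contractEdge_mk_adj_iff (a := 0) (b := 3)).2 (by decide +kernel))
  refine ⟨10, G, s(8, 9), he, hd, eq_two_mul_of_le (s := 2) (thStar_contractEdge_le_two_mul he hd)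
    (thStar_singleton_le (c := 0) ⟨_, he⟩ (by norm_num) ?_) ?_⟩
  · exact filledAfter_of_schedule ![0, 2, 2, 1, 2, 1, 2, 1, 1, 1]
      ![0, 8, 9, 0, 3, 0, 5, 0, 0, 0] (by decide +kernel) (by decide)
  · refine le_thStar_of_notFillable [(3, 1), (1, 3)] ?_ (by decide)
    have h := @notFillable_contractEdge _ G s(8, 9) _ 9
      [424, 256, 256, 17, 8, 65, 32, 1, 7] (fun a => min a.val 8) (by decide +kernel)
      (by decide +kernel) (fun i hi => ⟨⟨i, by omega⟩, by simp; omega⟩) (by decide +kernel)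
      (by decide +kernel)
    simp only [List.forall_mem_cons, List.not_mem_nil, false_imp_iff, implies_true, and_true]
    exact ⟨h (by decide +kernel), h (by decide +kernel)⟩

lemma thTimes_contractEdge_eq_two_mul :
    ∃ (n : ℕ) (G : SimpleGraph (Fin n)) (e : Sym2 (Fin n)),
      e ∈ G.edgeSet ∧ HasEdge (contractEdge G e) ∧
      thTimes .powerDomination (contractEdge G e) = 2 * thTimes .powerDomination G := by
  let G := edgeListGraph 8 [(0, 6), (0, 7), (6, 7), (1, 6), (2, 7), (0, 3), (3, 4), (0, 5)]
  have he : s(6, 7) ∈ G.edgeSet := show G.Adj 6 7 by decide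
  have hd : HasEdge (contractEdge G s(6, 7)) :=
    hasEdge_of_adj ((contractEdge_mk_adj_iff (a := 0) (b := 3)).2 (by decide +kernel))
  refine ⟨8, G, s(6, 7), he, hd, eq_two_mul_of_le (s := 1 + 2)
    (thTimes_contractEdge_le_two_mul _ _) (thTimes_singleton_le (c := 0) ?_) ?_⟩
  · exact filledAfter_of_schedule ![0, 2, 2, 1, 2, 1, 1, 1]
      ![0, 6, 7, 0, 3, 0, 0, 0] (by decide +kernel) (by decide)
  · have h := @notFillable_contractEdge _ G s(6, 7) _ 7
      [104, 64, 64, 17, 8, 1, 7] (fun a => min a.val 6) (by decide +kernel)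
      (by decide +kernel) (fun i hi => ⟨⟨i, by omega⟩, by simp; omega⟩) (by decide +kernel)
      (by decide +kernel)
    refine le_thTimes_of_notFillable ?_ [(2, 1), (1, 4)] ?_ (by decide)
    -- All vertices except `7` have distinct classes, so the contraction has at least seven
    -- vertices.
    · have hinj : Function.Injective
          (fun a : Fin 7 => Quotient.mk (endpointSetoid s((6 : Fin 8), 7)) a.castSucc) := by
        intro a b hab
        have := contractEdge_mk_injOn hab (Fin.castSucc_lt_last a).ne (Fin.castSucc_lt_last b).ne
        exact Fin.castSucc_injective _ this
      have := Nat.card_le_card_of_injective _ hinj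
      rw [Nat.card_fin] at this
      omega
    · simp only [List.forall_mem_cons, List.not_mem_nil, false_imp_iff, implies_true, and_true]
      exact ⟨h (by decide +kernel), h (by decide +kernel)⟩

/-! ### Edge subdivision -/

lemma thStar_eq_subdivideEdge (Y : Param) :
    ∃ (n : ℕ) (G : SimpleGraph (Fin n)) (e : Sym2 (Fin n)), e ∈ G.edgeSet ∧
      thStar Y G = thStar Y (subdivideEdge G e) := by
  let G := edgeListGraph 2 [(0, 1)]
  have he : s(0, 1) ∈ G.edgeSet := show G.Adj 0 1 by decide
  refine ⟨2, G, s(0, 1), he, le_antisymm (thStar_le_subdivideEdge Y he) ?_⟩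
  refine (thStar_star_le Y (hasEdge_subdivideEdge _ _) none ?_ ?_).trans
    (le_thStar_of_notFillable (c := 1) [] (by simp) (by decide))
  · rintro (_ | a) (_ | b) h
    · exact Or.inl rfl
    · exact Or.inl rfl
    · exact Or.inr rfl
    · have : ∀ a b : Fin 2, ¬ (G.Adj a b ∧ s(a, b) ≠ s(0, 1)) := by decide
      exact absurd h (this a b)
  · rintro (_ | a) h
    · exact absurd rfl h
    · have : ∀ a : Fin 2, a ∈ s(0, 1) := by decide
      exact this a

lemma thTimes_eq_subdivideEdge (Y : Param) :
    ∃ (n : ℕ) (G : SimpleGraph (Fin n)) (e : Sym2 (Fin n)), e ∈ G.edgeSet ∧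
      thTimes Y G = thTimes Y (subdivideEdge G e) := by
  let G := edgeListGraph 2 [(0, 1)]
  have he : s(0, 1) ∈ G.edgeSet := show G.Adj 0 1 by decide
  refine ⟨2, G, s(0, 1), he, le_antisymm (thTimes_le_subdivideEdge Y he) ?_⟩
  refine (thTimes_star_le Y none ?_ ?_).trans
    (le_thTimes_of_notFillable (c := 2) (by simp) [] (by simp) (by decide))
  · rintro (_ | a) (_ | b) h
    · exact Or.inl rfl
    · exact Or.inl rfl
    · exact Or.inr rfl
    · have : ∀ a b : Fin 2, ¬ (G.Adj a b ∧ s(a, b) ≠ s(0, 1)) := by decide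
      exact absurd h (this a b)
  · rintro (_ | a) h
    · exact absurd rfl h
    · have : ∀ a : Fin 2, a ∈ s(0, 1) := by decide
      exact this a

lemma notFillable_subdivideEdge_path (Y : Param) :
    NotFillable Y (subdivideEdge (edgeListGraph 3 [(0, 1), (0, 2)]) s(0, 2)) 1 1 := by
  refine notFillable_one_one Y ?_
  rintro (_ | a)
  · exact ⟨some 1, by simp, (by decide : ¬ (1 : Fin 3) ∈ s(0, 2))⟩
  · have : ∀ a : Fin 3, a ∉ s(0, 2) ∨
        ∃ b, b ≠ a ∧ ¬ ((edgeListGraph 3 [(0, 1), (0, 2)]).Adj a b ∧ s(a, b) ≠ s(0, 2)) := by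
      decide
    rcases this a with h | ⟨b, hb, h⟩
    · exact ⟨none, by simp, h⟩
    · exact ⟨some b, by simpa using hb, h⟩

lemma thStar_subdivideEdge_eq_two_mul (Y : Param) :
    ∃ (n : ℕ) (G : SimpleGraph (Fin n)) (e : Sym2 (Fin n)), e ∈ G.edgeSet ∧
      thStar Y (subdivideEdge G e) = 2 * thStar Y G := by
  let G := edgeListGraph 3 [(0, 1), (0, 2)]
  have he : s(0, 2) ∈ G.edgeSet := show G.Adj 0 2 by decide
  refine ⟨3, G, s(0, 2), he, eq_two_mul_of_le (s := 1) (thStar_subdivideEdge_le_two_mul Y he)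
    (thStar_star_le _ ⟨_, he⟩ 0 (by decide) (by decide)) ?_⟩
  exact le_thStar_of_notFillable [(1, 1)]
    (List.forall_mem_singleton.2 (notFillable_subdivideEdge_path Y)) (by decide)

lemma two_mul_thTimes_subdivideEdge_eq :
    ∃ (n : ℕ) (G : SimpleGraph (Fin n)) (e : Sym2 (Fin n)), e ∈ G.edgeSet ∧
      2 * thTimes .psdForcing (subdivideEdge G e) = 3 * thTimes .psdForcing G := by
  let G := edgeListGraph 3 [(0, 1), (0, 2)]
  have he : s(0, 2) ∈ G.edgeSet := show G.Adj 0 2 by decide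
  refine ⟨3, G, s(0, 2), he, le_antisymm (two_mul_thTimes_subdivideEdge_le he) ?_⟩
  have h1 : thTimes .psdForcing G ≤ 2 := thTimes_star_le _ 0 (by decide) (by decide)
  have h2 : ((3 : ℕ) : ℕ∞) ≤ thTimes .psdForcing (subdivideEdge G s(0, 2)) :=
    le_thTimes_of_notFillable (by simp) [(1, 1)]
      (List.forall_mem_singleton.2 (notFillable_subdivideEdge_path _)) (by decide)
  refine (mul_le_mul_right h1 3).trans (le_trans (by norm_num) (mul_le_mul_right h2 2))

lemma thTimes_subdivideEdge_eq_two_mul :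
    ∃ (n : ℕ) (G : SimpleGraph (Fin n)) (e : Sym2 (Fin n)), e ∈ G.edgeSet ∧
      thTimes .powerDomination (subdivideEdge G e) = 2 * thTimes .powerDomination G := by
  -- From the hub `0`, the vertices `1` and `2` fill their pendant vertices in the second step;
  -- after the subdivision of `12`, each of them also sees the unfilled new vertex, and the process
  -- stalls.
  let G := edgeListGraph 7 [(0, 1), (0, 2), (1, 2), (1, 3), (2, 4), (0, 5), (0, 6)]
  have he : s(1, 2) ∈ G.edgeSet := show G.Adj 1 2 by decide
  refine ⟨7, G, s(1, 2), he, eq_two_mul_of_le (s := 1 + 2)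
    thTimes_subdivideEdge_le_two_mul (thTimes_singleton_le (c := 0) ?_) ?_⟩
  · exact filledAfter_of_schedule ![0, 1, 1, 2, 2, 1, 1]
      ![0, 0, 0, 1, 2, 0, 0] (by decide +kernel) (by decide)
  · refine le_thTimes_of_notFillable (by simp) [(2, 1), (1, 4)] ?_ (by decide)
    have h := @notFillable_of_forallMasks _ (subdivideEdge G s(1, 2)) 8
      [102, 137, 145, 2, 4, 1, 1, 6] (fun a => a.elim 7 Fin.val) _ ?_ ?_ (by decide +kernel) ?_
    · simp only [List.forall_mem_cons, List.not_mem_nil, false_imp_iff, implies_true, and_true]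
      exact ⟨h (by decide +kernel), h (by decide +kernel)⟩
    · rintro (_ | a)
      · decide
      · exact a.2.trans (by norm_num)
    · intro i hi
      by_cases h7 : i = 7
      · exact ⟨none, h7.symm⟩
      · exact ⟨some ⟨i, by omega⟩, rfl⟩
    · have h1 : ∀ a b : Fin 7, (G.Adj a b ∧ s(a, b) ≠ s(1, 2)) ↔
          (([102, 137, 145, 2, 4, 1, 1, 6] : List ℕ).getD a.val 0).testBit b.val := by
        decide +kernel
      have h2 : ∀ a : Fin 7, a ∈ s((1 : Fin 7), 2) ↔
          (([102, 137, 145, 2, 4, 1, 1, 6] : List ℕ).getD a.val 0).testBit 7 := by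
        decide +kernel
      have h3 : ∀ a : Fin 7, a ∈ s((1 : Fin 7), 2) ↔ Nat.testBit 6 a.val := by
        decide +kernel
      rintro (_ | a) (_ | b)
      · exact (by decide : False ↔ Nat.testBit 6 7)
      · exact h3 b
      · exact h2 a
      · exact h1 a b

end Examples

end ProductThrottling

open ProductThrottling in
theorem proposition3p2 :
    -- The bounds, for every finite graph `G`, every edge `e` and every vertex `x` of `G`.
    (∀ (V : Type*) [Finite V] (G : SimpleGraph V),
      -- edge deletion
      (∀ (Y : Param) (e : Sym2 V), e ∈ G.edgeSet →
        (HasEdge (deleteEdge G e) →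
          thStar Y G ≤ 2 * thStar Y (deleteEdge G e) ∧
          thStar Y (deleteEdge G e) ≤ 2 * thStar Y G) ∧
        thTimes Y G ≤ 2 * thTimes Y (deleteEdge G e) ∧
        thTimes Y (deleteEdge G e) ≤ 2 * thTimes Y G) ∧
      -- vertex deletion
      (∀ (Y : Param) (x : V),
        (HasEdge (deleteVertex G x) → thStar Y G ≤ 2 * thStar Y (deleteVertex G x)) ∧
        (Nontrivial V → thTimes Y G ≤ 2 * thTimes Y (deleteVertex G x))) ∧
      -- edge contraction, power domination
      (∀ e : Sym2 V, e ∈ G.edgeSet →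
        (HasEdge (contractEdge G e) →
          thStar .powerDomination G ≤ 2 * thStar .powerDomination (contractEdge G e) ∧
          thStar .powerDomination (contractEdge G e) ≤ 2 * thStar .powerDomination G) ∧
        thTimes .powerDomination G ≤ 2 * thTimes .powerDomination (contractEdge G e) ∧
        thTimes .powerDomination (contractEdge G e) ≤ 2 * thTimes .powerDomination G) ∧
      -- edge contraction, positive semidefinite forcing
      (∀ e : Sym2 V, e ∈ G.edgeSet →
        (HasEdge (contractEdge G e) →
          thStar .psdForcing G ≤ 2 * thStar .psdForcing (contractEdge G e)) ∧
        thTimes .psdForcing G ≤ 2 * thTimes .psdForcing (contractEdge G e)) ∧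
      -- edge subdivision, no initial cost
      (∀ (Y : Param) (e : Sym2 V), e ∈ G.edgeSet →
        thStar Y G ≤ thStar Y (subdivideEdge G e) ∧
        thStar Y (subdivideEdge G e) ≤ 2 * thStar Y G) ∧
      -- edge subdivision, initial cost
      (∀ e : Sym2 V, e ∈ G.edgeSet →
        thTimes .powerDomination G ≤ thTimes .powerDomination (subdivideEdge G e) ∧
        thTimes .powerDomination (subdivideEdge G e) ≤ 2 * thTimes .powerDomination G ∧
        thTimes .psdForcing G ≤ thTimes .psdForcing (subdivideEdge G e) ∧
        2 * thTimes .psdForcing (subdivideEdge G e) ≤ 3 * thTimes .psdForcing G)) ∧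
    -- Sharpness: each bound is attained with equality, for each parameter it is claimed for.
    -- edge deletion
    (∀ Y : Param, ∃ (n : ℕ) (G : SimpleGraph (Fin n)) (e : Sym2 (Fin n)),
      e ∈ G.edgeSet ∧ HasEdge (deleteEdge G e) ∧
      thStar Y G = 2 * thStar Y (deleteEdge G e)) ∧
    (∀ Y : Param, ∃ (n : ℕ) (G : SimpleGraph (Fin n)) (e : Sym2 (Fin n)),
      e ∈ G.edgeSet ∧ HasEdge (deleteEdge G e) ∧
      thStar Y (deleteEdge G e) = 2 * thStar Y G) ∧
    (∀ Y : Param, ∃ (n : ℕ) (G : SimpleGraph (Fin n)) (e : Sym2 (Fin n)),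
      e ∈ G.edgeSet ∧ HasEdge (deleteEdge G e) ∧
      thTimes Y G = 2 * thTimes Y (deleteEdge G e)) ∧
    (∀ Y : Param, ∃ (n : ℕ) (G : SimpleGraph (Fin n)) (e : Sym2 (Fin n)),
      e ∈ G.edgeSet ∧ HasEdge (deleteEdge G e) ∧
      thTimes Y (deleteEdge G e) = 2 * thTimes Y G) ∧
    -- vertex deletion
    (∀ Y : Param, ∃ (n : ℕ) (G : SimpleGraph (Fin n)) (x : Fin n),
      HasEdge (deleteVertex G x) ∧
      thStar Y G = 2 * thStar Y (deleteVertex G x)) ∧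
    (∀ Y : Param, ∃ (n : ℕ) (G : SimpleGraph (Fin n)) (x : Fin n),
      HasEdge (deleteVertex G x) ∧
      thTimes Y G = 2 * thTimes Y (deleteVertex G x)) ∧
    -- edge contraction, power domination
    (∃ (n : ℕ) (G : SimpleGraph (Fin n)) (e : Sym2 (Fin n)),
      e ∈ G.edgeSet ∧ HasEdge (contractEdge G e) ∧
      thStar .powerDomination G = 2 * thStar .powerDomination (contractEdge G e)) ∧
    (∃ (n : ℕ) (G : SimpleGraph (Fin n)) (e : Sym2 (Fin n)),
      e ∈ G.edgeSet ∧ HasEdge (contractEdge G e) ∧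
      thStar .powerDomination (contractEdge G e) = 2 * thStar .powerDomination G) ∧
    (∃ (n : ℕ) (G : SimpleGraph (Fin n)) (e : Sym2 (Fin n)),
      e ∈ G.edgeSet ∧ HasEdge (contractEdge G e) ∧
      thTimes .powerDomination G = 2 * thTimes .powerDomination (contractEdge G e)) ∧
    (∃ (n : ℕ) (G : SimpleGraph (Fin n)) (e : Sym2 (Fin n)),
      e ∈ G.edgeSet ∧ HasEdge (contractEdge G e) ∧
      thTimes .powerDomination (contractEdge G e) = 2 * thTimes .powerDomination G) ∧
    -- edge contraction, positive semidefinite forcing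
    (∃ (n : ℕ) (G : SimpleGraph (Fin n)) (e : Sym2 (Fin n)),
      e ∈ G.edgeSet ∧ HasEdge (contractEdge G e) ∧
      thStar .psdForcing G = 2 * thStar .psdForcing (contractEdge G e)) ∧
    (∃ (n : ℕ) (G : SimpleGraph (Fin n)) (e : Sym2 (Fin n)),
      e ∈ G.edgeSet ∧ HasEdge (contractEdge G e) ∧
      thTimes .psdForcing G = 2 * thTimes .psdForcing (contractEdge G e)) ∧
    -- edge subdivision, no initial cost
    (∀ Y : Param, ∃ (n : ℕ) (G : SimpleGraph (Fin n)) (e : Sym2 (Fin n)), e ∈ G.edgeSet ∧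
      thStar Y G = thStar Y (subdivideEdge G e)) ∧
    (∀ Y : Param, ∃ (n : ℕ) (G : SimpleGraph (Fin n)) (e : Sym2 (Fin n)), e ∈ G.edgeSet ∧
      thStar Y (subdivideEdge G e) = 2 * thStar Y G) ∧
    -- edge subdivision, initial cost
    (∃ (n : ℕ) (G : SimpleGraph (Fin n)) (e : Sym2 (Fin n)), e ∈ G.edgeSet ∧
      thTimes .powerDomination G = thTimes .powerDomination (subdivideEdge G e)) ∧
    (∃ (n : ℕ) (G : SimpleGraph (Fin n)) (e : Sym2 (Fin n)), e ∈ G.edgeSet ∧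
      thTimes .powerDomination (subdivideEdge G e) = 2 * thTimes .powerDomination G) ∧
    (∃ (n : ℕ) (G : SimpleGraph (Fin n)) (e : Sym2 (Fin n)), e ∈ G.edgeSet ∧
      thTimes .psdForcing G = thTimes .psdForcing (subdivideEdge G e)) ∧
    (∃ (n : ℕ) (G : SimpleGraph (Fin n)) (e : Sym2 (Fin n)), e ∈ G.edgeSet ∧
      2 * thTimes .psdForcing (subdivideEdge G e) = 3 * thTimes .psdForcing G) := by
  refine ⟨fun V _ G => ⟨fun Y e he => ⟨fun h => ⟨?_, ?_⟩, ?_, ?_⟩,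
    fun Y x => ⟨fun h => ?_, fun _ => ?_⟩, fun e he => ⟨fun h => ⟨?_, ?_⟩, ?_, ?_⟩, fun e he => ⟨fun h => ?_, ?_⟩,
    fun Y e he => ⟨?_, ?_⟩, fun e he => ⟨?_, ?_, ?_, ?_⟩⟩,
    thStar_eq_two_mul_deleteEdge, thStar_deleteEdge_eq_two_mul, thTimes_eq_two_mul_deleteEdge,
    thTimes_deleteEdge_eq_two_mul, thStar_eq_two_mul_deleteVertex,
    thTimes_eq_two_mul_deleteVertex, thStar_eq_two_mul_contractEdge _,
    thStar_contractEdge_eq_two_mul, thTimes_eq_two_mul_contractEdge _,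
    thTimes_contractEdge_eq_two_mul, thStar_eq_two_mul_contractEdge _,
    thTimes_eq_two_mul_contractEdge _, thStar_eq_subdivideEdge, thStar_subdivideEdge_eq_two_mul,
    thTimes_eq_subdivideEdge _, thTimes_subdivideEdge_eq_two_mul, thTimes_eq_subdivideEdge _,
    two_mul_thTimes_subdivideEdge_eq⟩
  · exact thStar_le_two_mul_deleteEdge Y he h
  · exact thStar_deleteEdge_le_two_mul Y he h
  · exact thTimes_le_two_mul_deleteEdge G e Y
  · exact thTimes_deleteEdge_le_two_mul G e Y
  · exact thStar_le_two_mul_deleteVertex Y h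
  · exact thTimes_le_two_mul_deleteVertex G Y x
  · exact thStar_le_two_mul_contractEdge _ he h
  · exact thStar_contractEdge_le_two_mul he h
  · exact thTimes_le_two_mul_contractEdge G e _
  · exact thTimes_contractEdge_le_two_mul G e
  · exact thStar_le_two_mul_contractEdge _ he h
  · exact thTimes_le_two_mul_contractEdge G e _
  · exact thStar_le_subdivideEdge Y he
  · exact thStar_subdivideEdge_le_two_mul Y he
  · exact thTimes_le_subdivideEdge _ he
  · exact thTimes_subdivideEdge_le_two_mul
  · exact thTimes_le_subdivideEdge _ he
  · exact two_mul_thTimes_subdivideEdge_le he
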